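/- Let $\mathbb A$ be the ring of adeles of $\mathbb Q$. Let $d^\times t$ be the Haar measure on $\mathbb A^\times$ which is the product of $dt/|t|$ on $\mathbb R^\times$ and of the Haar measures on the $\mathbb Q_p^\times$ giving mass $1$ to $\mathbb Z_p^\times$; denote in the same way its quotient by the counting measure of $\mathbb Q^\times$ on $\mathbb A^\times/\mathbb Q^\times$ (so that $\mathrm{Vol}(\mathbb A_1^\times/\mathbb Q^\times)=1$). Let $|\cdot|$ be the idele norm. For a function $\varphi:\mathbb A^2\to\mathbb C$, $g\in \mathrm{GL}_2(\mathbb A)$, a unitary Hecke character $\omega$ and $s\in\mathbb C$, put $$\Theta(\varphi)(g)=\sum_{v\in\mathbb Q^2\setminus\{0\}}\varphi(g^{-1}v),\qquad E_{\omega,s}(\varphi)(g)=|\det g|^{-s}\int_{\mathbb A^\times/\mathbb Q^\times}\omega(t)\,|t|^{2s}\,\Theta(\varphi)(g/t)\,d^\times t .$$ Let $k\ge 2$ be an integer and $\varphi(x)=\mathbf 1_{\hat{\mathbb Z}^2}(x_f)\,\varphi_\infty(x_\infty)$ with $\varphi_\infty(v_1,v_2)=e^{-\pi(v_1^2+v_2^2)}(v_1+iv_2)^k$,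 and take $\omega=1$. For $z=x+iy$ with $y>0$, let $g_z\in \mathrm{GL}_2(\mathbb A)$ have trivial finite part and archimedean part $\begin{pmatrix}1&x\\0&1\end{pmatrix}\begin{pmatrix}y^{1/2}&0\\0&y^{-1/2}\end{pmatrix}$. Then: 1. For every $t\in\mathbb A^\times$ the series $\Theta(\varphi)(g_z/t)$ converges absolutely; for $\Re(s)>0$ the integral defining $E_{1,s}(\varphi)(g_z)$ converges absolutely; and $s\mapsto E_{1,s}(\varphi)(g_z)$ is holomorphic on $\Re(s)>0$. 2. For $\Re(s)>1$ the following series converges absolutely and $$E_{1,s}(\varphi)(g_z)=\tfrac12\,y^{s}\,\frac{\Gamma(s+\frac k2)}{\pi^{s+\frac k2}}\sum_{v\in\mathbb Z^2\setminus\{0\}}(v_1-v_2\bar z)^k\,|v_1-v_2\bar z|^{-k-2s}.$$ (By 1, for $0<\Re(s)\le1$ the left side is the analytic continuation of the right side.) 3. If $k\ge3$, then at $s=k/2$ one gets the classical Eisenstein series, with an absolutely convergent sum: $$E_{1,\frac k2}(\varphi)(g_z)=\tfrac12\,y^{\frac k2}\,\frac{\Gamma(k)}{\pi^k}\sum_{v\in\mathbb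 Z^2\setminus\{0\}}(v_1+v_2z)^{-k}.$$ 4. For every $k\ge2$ (in particular $k=2$) the same formula holds with Hecke summation: for $\varepsilon>0$ the following series converges absolutely, and $$E_{1,\frac k2}(\varphi)(g_z)=\lim_{\varepsilon\to0^+}\tfrac12\,y^{\frac k2}\,\frac{\Gamma(k)}{\pi^k}\sum_{v\in\mathbb Z^2\setminus\{0\}}(v_1+v_2z)^{-k}\,|v_1+v_2z|^{-2\varepsilon}.$$ -/

import Mathlib

open NumberField IsDedekindDomain MeasureTheory Filter Topology UpperHalfPlane
open scoped ENNReal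

noncomputable section

namespace AdelicEisenstein

/-- The ring of adeles of `ℚ`. -/
abbrev Adele : Type := AdeleRing (𝓞 ℚ) ℚ

/-- The ring of finite adeles of `ℚ`. -/
abbrev FinAdele : Type := FiniteAdeleRing (𝓞 ℚ) ℚ

/-- The group of ideles of `ℚ`, with its usual (unit group) topology. -/
abbrev Idele : Type := Adeleˣ

/-- The ring isomorphism between the archimedean part of the adeles of `ℚ` and `ℝ`. -/
def infEquiv : InfiniteAdeleRing ℚ ≃+* ℝ :=
  (RingEquiv.piUnique (fun v : InfinitePlace ℚ => v.Completion)).trans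
    (InfinitePlace.Completion.ringEquivRealOfIsReal Rat.isReal_infinitePlace)

/-- The archimedean coordinate `x_∞ ∈ ℝ` of an adele. -/
def infCoord (x : Adele) : ℝ := infEquiv x.1

/-- The finite adeles which are integral at every finite place. -/
def zHat : Set FinAdele := {x | ∀ v, x v ∈ v.adicCompletionIntegers ℚ}

/-- The idele norm: the product over all places of the normalized absolute values. -/
def ideleNorm (t : Idele) : ℝ :=
  ‖(t : Adele).1‖ * ∏ᶠ v : HeightOneSpectrum (𝓞 ℚ), ‖(t : Adele).2 v‖

/-- The diagonally embedded multiplicative group `ℚˣ` inside the ideles. -/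
def principalIdeles : Subgroup Idele :=
  (Units.map (algebraMap ℚ Adele).toMonoidHom).range

/-! ### Haar measure on the ideles and on the idele class group -/

instance : MeasurableSpace Idele := borel Idele
instance : BorelSpace Idele := ⟨rfl⟩

/-- The ideles `t` with `1 ≤ t_∞ ≤ e` which are units at every finite place. -/
def unitBox : Set Idele :=
  {t | infCoord (t : Adele) ∈ Set.Icc 1 (Real.exp 1) ∧
    (t : Adele).2 ∈ zHat ∧ ((t⁻¹ : Idele) : Adele).2 ∈ zHat}

theorem isHomeomorph_infEquiv : IsHomeomorph infEquiv := by
  have h1 : IsHomeomorph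
      (InfinitePlace.Completion.ringEquivRealOfIsReal Rat.isReal_infinitePlace) :=
    (InfinitePlace.Completion.isometryEquivRealOfIsReal
      Rat.isReal_infinitePlace).toHomeomorph.isHomeomorph
  have h2 : IsHomeomorph (RingEquiv.piUnique (fun v : InfinitePlace ℚ => v.Completion)) :=
    (Homeomorph.piUnique (fun v : InfinitePlace ℚ => v.Completion)).isHomeomorph
  exact h1.comp h2

theorem continuous_infCoord : Continuous infCoord :=
  isHomeomorph_infEquiv.continuous.comp continuous_fst

theorem isOpen_zHat : IsOpen zHat :=
  RestrictedProduct.isOpen_forall_mem fun _ => Valued.isOpen_valuationSubring _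

theorem isCompact_zHat : IsCompact zHat := by
  have hc (v : HeightOneSpectrum (𝓞 ℚ)) : CompactSpace (v.adicCompletionIntegers ℚ) := by
    have e := (Rat.HeightOneSpectrum.adicCompletionIntegers.padicIntEquiv v)
    have : Fact (Nat.Prime (Rat.HeightOneSpectrum.primesEquiv v).1) :=
      ⟨(Rat.HeightOneSpectrum.primesEquiv v).2⟩
    exact e.toHomeomorph.symm.compactSpace
  have h := isCompact_range (RestrictedProduct.isEmbedding_structureMap
    (R := fun v : HeightOneSpectrum (𝓞 ℚ) => v.adicCompletion ℚ)
    (A := fun v => (v.adicCompletionIntegers ℚ : Set (v.adicCompletion ℚ)))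
    (𝓕 := Filter.cofinite)).continuous
  have hz : zHat = Set.range (RestrictedProduct.structureMap
      (fun v : HeightOneSpectrum (𝓞 ℚ) => v.adicCompletion ℚ)
      (fun v => (v.adicCompletionIntegers ℚ : Set (v.adicCompletion ℚ))) Filter.cofinite) :=
    Set.ext fun x =>
      ⟨fun hx => ⟨fun v => ⟨x v, hx v⟩, rfl⟩, by rintro ⟨y, rfl⟩ v; exact (y v).2⟩
  rw [hz]
  exact h

instance : T2Space FinAdele := by
  have h0 (v : HeightOneSpectrum (𝓞 ℚ)) : T2Space (v.adicCompletion ℚ) := by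
    have : Fact (Nat.Prime (Rat.HeightOneSpectrum.primesEquiv v).1) :=
      ⟨(Rat.HeightOneSpectrum.primesEquiv v).2⟩
    exact (Rat.HeightOneSpectrum.adicCompletion.padicEquiv
      v).toHomeomorph.isEmbedding.t2Space
  have h2 : T2Space (RestrictedProduct (fun v : HeightOneSpectrum (𝓞 ℚ) => v.adicCompletion ℚ)
      (fun v => (v.adicCompletionIntegers ℚ : Set (v.adicCompletion ℚ))) Filter.cofinite) :=
    inferInstance
  exact h2

instance : T2Space Adele := by
  have h1 : T2Space (InfiniteAdeleRing ℚ) := isHomeomorph_infEquiv.isEmbedding.t2Space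
  exact inferInstanceAs (T2Space (InfiniteAdeleRing ℚ × FinAdele))

theorem continuous_val_fin : Continuous fun t : Idele => (t : Adele).2 :=
  continuous_snd.comp Units.continuous_val

theorem infCoord_mul (x y : Adele) : infCoord (x * y) = infCoord x * infCoord y :=
  map_mul infEquiv x.1 y.1

theorem infCoord_one : infCoord 1 = 1 := map_one infEquiv

theorem isCompact_unitBox : IsCompact unitBox := by
  have hinv (t : Idele) : infCoord (t : Adele) * infCoord ((t⁻¹ : Idele) : Adele) = 1 := by
    rw [← infCoord_mul, Units.mul_inv, infCoord_one]
  have hK : IsCompact ((infEquiv ⁻¹' Set.Icc (Real.exp (-1)) (Real.exp 1)) ×ˢ zHat) :=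
    (isHomeomorph_infEquiv.isClosedEmbedding.isCompact_preimage isCompact_Icc).prod isCompact_zHat
  have hK2 := hK.prod (hK.image MulOpposite.continuous_op)
  refine ((Units.isClosedEmbedding_embedProduct (α := Adele)).isCompact_preimage
    hK2).of_isClosed_subset ?_ ?_
  · have hc := isCompact_zHat.isClosed
    exact (isClosed_Icc.preimage (continuous_infCoord.comp Units.continuous_val)).inter
      ((hc.preimage continuous_val_fin).inter
        (hc.preimage (continuous_val_fin.comp continuous_inv)))
  · rintro t ⟨⟨h1, h2⟩, h3, h4⟩
    have h := hinv t
    have e1 : Real.exp (-1) ≤ 1 := Real.exp_le_one_iff.2 (by norm_num)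
    have e2 : (1 : ℝ) ≤ Real.exp 1 := Real.one_le_exp (by norm_num)
    have e3 : Real.exp (-1) * Real.exp 1 = 1 := by rw [← Real.exp_add]; simp
    have hb : infCoord ((t⁻¹ : Idele) : Adele) = (infCoord (t : Adele))⁻¹ :=
      eq_inv_of_mul_eq_one_right h
    refine ⟨⟨⟨e1.trans h1, h2⟩, h3⟩, ⟨_, ⟨⟨?_, ?_⟩, h4⟩, rfl⟩⟩
    · change _ ≤ infCoord ((t⁻¹ : Idele) : Adele)
      rw [hb, Real.exp_neg]
      exact inv_anti₀ (by linarith) h2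
    · change infCoord ((t⁻¹ : Idele) : Adele) ≤ _
      rw [hb]
      exact (inv_le_one_of_one_le₀ h1).trans e2

/-- The idele with archimedean coordinate `r` and trivial finite part. -/
def infIdele : ℝˣ →* Idele where
  toFun r := ⟨(infEquiv.symm r, 1), (infEquiv.symm (r⁻¹ : ℝˣ), 1),
    Prod.ext ((map_mul infEquiv.symm (r : ℝ) (r⁻¹ : ℝˣ)).symm.trans (by simp; rfl)) (mul_one _),
    Prod.ext ((map_mul infEquiv.symm ((r⁻¹ : ℝˣ) : ℝ) r).symm.trans (by simp; rfl)) (mul_one _)⟩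
  map_one' := Units.ext (Prod.ext (map_one infEquiv.symm) rfl)
  map_mul' r r' := Units.ext (Prod.ext (map_mul infEquiv.symm (r : ℝ) r') (mul_one _).symm)

theorem one_mem_zHat : (1 : FinAdele) ∈ zHat := fun v => one_mem (v.adicCompletionIntegers ℚ)

theorem nonempty_interior_unitBox : (interior unitBox).Nonempty := by
  have ho : IsOpen {t : Idele | infCoord (t : Adele) ∈ Set.Ioo 1 (Real.exp 1) ∧
      (t : Adele).2 ∈ zHat ∧ ((t⁻¹ : Idele) : Adele).2 ∈ zHat} :=
    (isOpen_Ioo.preimage (continuous_infCoord.comp Units.continuous_val)).inter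
      ((isOpen_zHat.preimage continuous_val_fin).inter
        (isOpen_zHat.preimage (continuous_val_fin.comp continuous_inv)))
  refine ⟨infIdele (Units.mk0 (Real.exp (1 / 2)) (Real.exp_ne_zero _)),
    interior_maximal ?_ ho ⟨?_, one_mem_zHat, one_mem_zHat⟩⟩
  · exact fun t ht => ⟨Set.Ioo_subset_Icc_self ht.1, ht.2⟩
  · change infEquiv (infEquiv.symm (Real.exp (1 / 2))) ∈ _
    rw [RingEquiv.apply_symm_apply]
    exact ⟨Real.one_lt_exp_iff.2 (by norm_num), Real.exp_lt_exp.2 (by norm_num)⟩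

/-- The usual Haar measure `d^× t` on the ideles, the product of `dt / |t|` on `ℝˣ` and of the
local Haar measures giving mass `1` to the local units: it is the Haar measure giving to
`[1, e] × ∏ ℤ_pˣ` the mass `∫_1^e dt / t = 1`. -/
def ideleHaar : Measure Idele :=
  Measure.haarMeasure ⟨⟨unitBox, isCompact_unitBox⟩, nonempty_interior_unitBox⟩

open Classical in
/-- The quotient of the measure `μ` on `G` by the counting measure on the subgroup `Γ`: the image
under `G → G ⧸ Γ` of the restriction of `μ` to a fundamental domain of `Γ`. -/
def quotientMeasure {G : Type*} [Group G] [MeasurableSpace G] (Γ : Subgroup G) (μ : Measure G) :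
    Measure (G ⧸ Γ) :=
  if h : ∃ D : Set G, IsFundamentalDomain Γ.op D μ then
    (μ.restrict h.choose).map (QuotientGroup.mk : G → G ⧸ Γ)
  else 0

/-- The group `𝔸ˣ / ℚˣ`. -/
abbrev IdeleClass : Type := Idele ⧸ principalIdeles

/-- The measure `d^× t` on `𝔸ˣ / ℚˣ`. -/
def ideleClassHaar : Measure IdeleClass := quotientMeasure principalIdeles ideleHaar

/-! ### Theta functions and Eisenstein series -/

/-- The action `(g φ)(x) = φ(g⁻¹ x)` of `GL₂(𝔸)` on functions on `𝔸²`. -/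
def act (g : GL (Fin 2) Adele) (φ : (Fin 2 → Adele) → ℂ) : (Fin 2 → Adele) → ℂ :=
  fun x => φ (((g⁻¹ : GL (Fin 2) Adele) : Matrix (Fin 2) (Fin 2) Adele).mulVec x)

/-- The term of index `v ∈ ℚ² ∖ {0}` of the series `Θ(φ)(g)`. -/
def thetaTerm (φ : (Fin 2 → Adele) → ℂ) (g : GL (Fin 2) Adele) (v : {v : Fin 2 → ℚ // v ≠ 0}) : ℂ :=
  act g φ (fun i => algebraMap ℚ Adele (v.1 i))

/-- `Θ(φ)(g) = ∑_{v ∈ ℚ² ∖ {0}} (g φ)(v)`. -/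
def theta (φ : (Fin 2 → Adele) → ℂ) (g : GL (Fin 2) Adele) : ℂ := ∑' v, thetaTerm φ g v

/-- The matrix `g / t`, for an idele `t`. -/
def divIdele (g : GL (Fin 2) Adele) (t : Idele) : GL (Fin 2) Adele :=
  Matrix.GeneralLinearGroup.scalar (Fin 2) t⁻¹ * g

/-- The function `ω(t) |t|^{2s} Θ(φ)(g / t)` of `t ∈ 𝔸ˣ / ℚˣ`, for a unitary Hecke character `ω`.
Its value does not depend on the representative of the class. -/
def eisIntegrand (ω : IdeleClass →ₜ* Circle) (s : ℂ) (φ : (Fin 2 → Adele) → ℂ)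
    (g : GL (Fin 2) Adele) (q : IdeleClass) : ℂ :=
  (ω q : ℂ) * (ideleNorm q.out : ℂ) ^ (2 * s) * theta φ (divIdele g q.out)

/-- The (analytic) Eisenstein series
`E_{ω,s}(φ)(g) = |det g|^{-s} ∫_{𝔸ˣ/ℚˣ} ω(t) |t|^{2s} Θ(φ)(g / t) d^×t`. -/
def eisenstein (ω : IdeleClass →ₜ* Circle) (s : ℂ) (φ : (Fin 2 → Adele) → ℂ)
    (g : GL (Fin 2) Adele) : ℂ :=
  (ideleNorm (Matrix.GeneralLinearGroup.det g) : ℂ) ^ (-s) *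
    ∫ q, eisIntegrand ω s φ g q ∂ideleClassHaar

/-! ### The test function of weight `k` and the matrix attached to a point of the half-plane -/

/-- The archimedean test function `(v₁, v₂) ↦ exp(-π (v₁² + v₂²)) (v₁ + i v₂)^k`. -/
def phiInf (k : ℕ) (v : Fin 2 → ℝ) : ℂ :=
  (Real.exp (-Real.pi * (v 0 ^ 2 + v 1 ^ 2)) : ℂ) * ((v 0 : ℂ) + Complex.I * (v 1 : ℂ)) ^ k

/-- The finite test function, the indicator function of `Ẑ²`. -/
def phiFin : (Fin 2 → FinAdele) → ℂ := Set.indicator {x | ∀ i, x i ∈ zHat} 1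

/-- The test function `φ(x) = φ_f(x_f) φ_∞(x_∞)` of weight `k`. -/
def phi (k : ℕ) (x : Fin 2 → Adele) : ℂ :=
  phiFin (fun i => (x i).2) * phiInf k (fun i => infCoord (x i))

/-- The adele with archimedean coordinate `r` and finite part `b`. -/
def mkAdele (r : ℝ) (b : FinAdele) : Adele := (infEquiv.symm r, b)

/-- The adelic matrix with entries of archimedean part `M i j` and with finite part the identity. -/
def infMatrix (M : Matrix (Fin 2) (Fin 2) ℝ) : Matrix (Fin 2) (Fin 2) Adele :=
  Matrix.of fun i j => mkAdele (M i j) ((1 : Matrix (Fin 2) (Fin 2) FinAdele) i j)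

theorem mkAdele_add (r r' : ℝ) (b b' : FinAdele) :
    mkAdele (r + r') (b + b') = mkAdele r b + mkAdele r' b' :=
  Prod.ext (map_add infEquiv.symm r r') rfl

theorem mkAdele_mul (r r' : ℝ) (b b' : FinAdele) :
    mkAdele (r * r') (b * b') = mkAdele r b * mkAdele r' b' :=
  Prod.ext (map_mul infEquiv.symm r r') rfl

theorem infMatrix_mul (M N : Matrix (Fin 2) (Fin 2) ℝ) :
    infMatrix (M * N) = infMatrix M * infMatrix N := by
  ext i j
  have h : (1 : Matrix (Fin 2) (Fin 2) FinAdele) i j =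
      ((1 : Matrix (Fin 2) (Fin 2) FinAdele) * (1 : Matrix (Fin 2) (Fin 2) FinAdele)) i j := by
    rw [mul_one]
  simp only [infMatrix, Matrix.mul_apply, Matrix.of_apply]
  rw [h]
  simp only [Matrix.mul_apply, Fin.sum_univ_two, mkAdele_add, mkAdele_mul]

theorem infMatrix_one : infMatrix 1 = 1 := by
  ext i j
  rcases eq_or_ne i j with rfl | h
  · simp only [infMatrix, Matrix.of_apply, Matrix.one_apply_eq]
    exact Prod.ext (map_one infEquiv.symm) rfl
  · simp only [infMatrix, Matrix.of_apply, Matrix.one_apply_ne h]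
    exact Prod.ext (map_zero infEquiv.symm) rfl

/-- The embedding of `GL₂(ℝ)` in `GL₂(𝔸)`, with trivial finite part. -/
def infGL (M : GL (Fin 2) ℝ) : GL (Fin 2) Adele where
  val := infMatrix M
  inv := infMatrix (M⁻¹ : GL (Fin 2) ℝ)
  val_inv := by rw [← infMatrix_mul, Units.mul_inv, infMatrix_one]
  inv_val := by rw [← infMatrix_mul, Units.inv_mul, infMatrix_one]

/-- For `z = x + i y`, the real matrix `(1 x; 0 1) (y^{1/2} 0; 0 y^{-1/2})`. -/
def realMatrix (z : ℍ) : GL (Fin 2) ℝ :=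
  Matrix.GeneralLinearGroup.mkOfDetNeZero
    (!![1, z.re; 0, 1] * !![√z.im, 0; 0, (√z.im)⁻¹])
    (by
      have h : √z.im ≠ 0 := (Real.sqrt_pos.2 z.im_pos).ne'
      simp [Matrix.det_fin_two_of, h])

/-- The adelic matrix `g_z`: the matrix above at the infinite place, the identity elsewhere. -/
def gMat (z : ℍ) : GL (Fin 2) Adele := infGL (realMatrix z)

end AdelicEisenstein
end

noncomputable section

namespace AdelicEisenstein

/-! ### Principal ideles and the idele norm -/

/-! Because ℚ has class number one and units ±1, `ideleDomain`, that is ℝ_{>0} × ∏ ℤ_pˣ, is a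
fundamental domain for ℚˣ, and on it the idele norm is the archimedean coordinate r. So integrating
a function of the norm over the class group means integrating over (0, ∞) against dr/r
(`integral_comp_classNorm`), with constant 1 by the normalization on `unitBox`. On the same domain
the finite test function cuts ℚ² down to ℤ², and Θ becomes an elementary factor times `latticeTheta`
at T = r² (`hasSum_thetaTerm`). Hence E is, up to the factor y^{-k/2}/2, the Mellin transform of
`latticeTheta` at s + k/2 (`eisenstein_eq_mellin`).

For k ≠ 0 the zero vector contributes nothing, so `latticeTheta` decays exponentially at infinity;
`latticeTheta_functional_equation`, relating T and 1/T, then bounds it near 0. This yields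
convergence and holomorphy for Re s > 0. The functional equation comes from Poisson summation in
each variable, applied to a Gaussian series twisted by exp(2πwP) with P = v₁ - v₂z̄
(`tsum_genTerm`). No factor exp(cw²) survives, because the real and imaginary parts of P are
orthonormal coordinates for |P|² and the vector (1, i) is isotropic; k derivatives at w = 0 thus
produce P^k alone.

For Re s > 1 the Mellin transform may be taken term by term (`hasSum_eisenstein`). At s = k/2 the
identity P^k |P|^{-2k} = P̄^{-k} gives the holomorphic series. The Hecke limit is just continuity of
E at k/2, a point inside the half-plane of holomorphy. -/

/-- The diagonal embedding of `ℚˣ` in the ideles. -/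
def principalIdele : ℚˣ →* Idele := Units.map (algebraMap ℚ Adele).toMonoidHom

theorem principalIdele_val (q : ℚˣ) : (principalIdele q : Adele) = algebraMap ℚ Adele q := rfl

theorem mem_principalIdeles_iff {t : Idele} :
    t ∈ principalIdeles ↔ ∃ q : ℚˣ, principalIdele q = t := Iff.rfl

/-- The archimedean coordinate as a ring homomorphism. -/
def infCoordHom : Adele →+* ℝ :=
  infEquiv.toRingHom.comp (RingHom.fst (InfiniteAdeleRing ℚ) FinAdele)

theorem infCoord_algebraMap (q : ℚ) : infCoord (algebraMap ℚ Adele q) = q :=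
  eq_ratCast (infCoordHom.comp (algebraMap ℚ Adele)) q

theorem infCoord_ne_zero (t : Idele) : infCoord t ≠ 0 :=
  (t.isUnit.map infCoordHom).ne_zero

theorem mult_default_infinitePlace : (default : InfinitePlace ℚ).mult = 1 := by
  rw [Subsingleton.elim default Rat.infinitePlace]
  exact InfinitePlace.mult_isReal ⟨_, Rat.isReal_infinitePlace⟩

theorem norm_fst (x : Adele) : ‖x.1‖ = |infCoord x| := by
  rw [InfiniteAdeleRing.norm_def, Fintype.prod_unique, infCoord, infEquiv,
    mult_default_infinitePlace, pow_one]
  have := (InfinitePlace.Completion.isometryEquivRealOfIsReal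
    Rat.isReal_infinitePlace).isometry.norm_map_of_map_zero
    (map_zero (InfinitePlace.Completion.ringEquivRealOfIsReal Rat.isReal_infinitePlace)) (x.1 default)
  exact this.symm

/-! ### Rational numbers with prescribed valuations. -/

theorem valuation_natGenerator_of_ne {v w : HeightOneSpectrum (𝓞 ℚ)} (h : w ≠ v) :
    w.valuation ℚ (Rat.HeightOneSpectrum.natGenerator v : ℚ) = 1 := by
  have : Fact (Nat.Prime (Rat.HeightOneSpectrum.primesEquiv w).1) :=
    ⟨(Rat.HeightOneSpectrum.primesEquiv w).2⟩
  rw [(Rat.HeightOneSpectrum.valuation_equiv_padicValuation w).eq_one_iff_eq_one]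
  have h2 := Rat.padicValuation_cast (Rat.HeightOneSpectrum.primesEquiv w).1
    (Rat.HeightOneSpectrum.natGenerator v : ℤ)
  rw [Int.cast_natCast] at h2
  rw [h2, Int.padicValuation_eq_one_iff]
  intro hd
  have hd' := Int.natCast_dvd_natCast.1 hd
  have := (Nat.prime_dvd_prime_iff_eq (Rat.HeightOneSpectrum.primesEquiv w).2
    (Rat.HeightOneSpectrum.prime_natGenerator v)).1 hd'
  exact h (Rat.HeightOneSpectrum.primesEquiv.injective (Subtype.ext this))

/-- The valuation at v is compared with the p-adic one by an equivalence, not an equality. The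
exponent is read off p-adically and transported through the statement that x / p^n has value one. -/
theorem exists_zpow_valuation_eq (v : HeightOneSpectrum (𝓞 ℚ)) {x : ℚ} (hx : x ≠ 0) :
    ∃ n : ℤ, v.valuation ℚ ((Rat.HeightOneSpectrum.natGenerator v : ℚ) ^ n) =
      v.valuation ℚ x := by
  have hp : Fact (Nat.Prime (Rat.HeightOneSpectrum.primesEquiv v).1) :=
    ⟨(Rat.HeightOneSpectrum.primesEquiv v).2⟩
  have hp0 : (Rat.HeightOneSpectrum.natGenerator v : ℚ) ≠ 0 :=
    Nat.cast_ne_zero.2 (Rat.HeightOneSpectrum.prime_natGenerator v).ne_zero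
  have hv := Rat.HeightOneSpectrum.valuation_equiv_padicValuation v
  have hs : Rat.padicValuation (Rat.HeightOneSpectrum.primesEquiv v).1
      (Rat.HeightOneSpectrum.natGenerator v : ℚ) = WithZero.exp (-1) :=
    Rat.padicValuation_self (Rat.HeightOneSpectrum.primesEquiv v).1
  have h0 : Rat.padicValuation (Rat.HeightOneSpectrum.primesEquiv v).1 x ≠ 0 := by
    rwa [Ne, Rat.padicValuation_eq_zero_iff]
  obtain ⟨m, hm⟩ : ∃ m : ℤ, WithZero.exp m =
      Rat.padicValuation (Rat.HeightOneSpectrum.primesEquiv v).1 x :=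
    ⟨_, WithZero.exp_log h0⟩
  -- The prime has value exp (-1), so the sign of the exponent is reversed.
  refine ⟨-m, ?_⟩
  have h1 := (hv.eq_one_iff_eq_one (x := x / (Rat.HeightOneSpectrum.natGenerator v : ℚ) ^ (-m))).2
    (by rw [map_div₀, map_zpow₀, hs, ← hm, ← WithZero.exp_zsmul, ← WithZero.exp_sub]; simp)
  rw [map_div₀, div_eq_one_iff_eq ((map_ne_zero _).2 (zpow_ne_zero _ hp0))] at h1
  exact h1.symm

/-- There is a positive rational number with prescribed valuation at every finite place. -/
theorem exists_rat_valuation_eq (f : HeightOneSpectrum (𝓞 ℚ) → WithZero (Multiplicative ℤ))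
    (hf : ∀ v, f v ≠ 0) (hfin : ∀ᶠ v in cofinite, f v = 1) :
    ∃ q : ℚ, 0 < q ∧ ∀ v : HeightOneSpectrum (𝓞 ℚ), v.valuation ℚ q = f v := by
  classical
  have h1 (v : HeightOneSpectrum (𝓞 ℚ)) : ∃ n : ℤ,
      v.valuation ℚ ((Rat.HeightOneSpectrum.natGenerator v : ℚ) ^ n) = f v := by
    obtain ⟨x, hx⟩ := v.valuation_surjective ℚ (f v)
    have hx0 : x ≠ 0 := by
      rintro rfl
      exact hf v (by rw [← hx, map_zero])
    obtain ⟨n, hn⟩ := exists_zpow_valuation_eq v hx0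
    exact ⟨n, hn.trans hx⟩
  choose n hn using h1
  have hfin' : {v | f v ≠ 1}.Finite := hfin
  refine ⟨∏ v ∈ hfin'.toFinset, (Rat.HeightOneSpectrum.natGenerator v : ℚ) ^ n v,
    Finset.prod_pos fun v _ => zpow_pos
      (Nat.cast_pos.2 (Rat.HeightOneSpectrum.prime_natGenerator v).pos) _, fun w => ?_⟩
  rw [map_prod]
  have h2 : ∀ v, v ≠ w →
      w.valuation ℚ ((Rat.HeightOneSpectrum.natGenerator v : ℚ) ^ n v) = 1 := by
    intro v hv
    rw [map_zpow₀, valuation_natGenerator_of_ne hv.symm, one_zpow]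
  by_cases hw : f w = 1
  · rw [hw]
    refine Finset.prod_eq_one fun v hv => h2 v ?_
    rintro rfl
    exact (hfin'.mem_toFinset.1 hv) hw
  · rw [Finset.prod_eq_single w (fun v _ hv => h2 v hv)
      (fun h => absurd (hfin'.mem_toFinset.2 hw) h), hn]

theorem mem_zHat_iff {x : FinAdele} : x ∈ zHat ↔ ∀ v, Valued.v (x v) ≤ 1 := Iff.rfl

/-- The elements of ℚ integral at all finite places form 𝓞 ℚ = ℤ. This is what turns sums over ℚ²
into sums over ℤ². -/
theorem algebraMap_mem_zHat_iff {q : ℚ} :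
    (algebraMap ℚ Adele q).2 ∈ zHat ↔ ∃ n : ℤ, (n : ℚ) = q := by
  have h1 : (algebraMap ℚ Adele q).2 ∈ zHat ↔
      ∀ v : HeightOneSpectrum (𝓞 ℚ), v.valuation ℚ q ≤ 1 := by
    refine mem_zHat_iff.trans (forall_congr' fun v => ?_)
    rw [← HeightOneSpectrum.valuedAdicCompletion_eq_valuation']
    rfl
  rw [h1]
  constructor
  · intro h
    obtain ⟨r, hr⟩ := HeightOneSpectrum.mem_integers_of_valuation_le_one ℚ q h
    exact ⟨Rat.ringOfIntegersEquiv r, by rw [Rat.ringOfIntegersEquiv_apply_coe]; exact hr⟩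
  · rintro ⟨n, rfl⟩ v
    simpa using v.valuation_le_one (K := ℚ) (n : 𝓞 ℚ)

theorem finite_coord_mul_inv (t : Idele) (v : HeightOneSpectrum (𝓞 ℚ)) :
    (t : Adele).2 v * ((t⁻¹ : Idele) : Adele).2 v = 1 := by
  have h : ((t : Adele) * ((t⁻¹ : Idele) : Adele)).2 v = (1 : Adele).2 v := by rw [Units.mul_inv]
  exact h

theorem finite_coord_ne_zero (t : Idele) (v : HeightOneSpectrum (𝓞 ℚ)) : (t : Adele).2 v ≠ 0 :=
  left_ne_zero_of_mul_eq_one (finite_coord_mul_inv t v)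

theorem isUnit_snd (t : Idele) : IsUnit (t : Adele).2 :=
  t.isUnit.map (RingHom.snd (InfiniteAdeleRing ℚ) FinAdele)

theorem eventually_valued_eq_one (t : Idele) :
    ∀ᶠ v in cofinite, Valued.v ((t : Adele).2 v) = 1 :=
  (FiniteAdeleRing.isUnit_iff.1 (isUnit_snd t)).2

/-- The ideles which are units at every finite place. -/
def finUnits : Set Idele := {t | (t : Adele).2 ∈ zHat ∧ ((t⁻¹ : Idele) : Adele).2 ∈ zHat}

theorem mem_finUnits_iff {t : Idele} : t ∈ finUnits ↔ ∀ v, Valued.v ((t : Adele).2 v) = 1 := by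
  have h (v : HeightOneSpectrum (𝓞 ℚ)) : Valued.v ((t : Adele).2 v) *
      Valued.v (((t⁻¹ : Idele) : Adele).2 v) = 1 := by
    rw [← map_mul, finite_coord_mul_inv, map_one]
  constructor
  · rintro ⟨h1, h2⟩ v
    have h3 : Valued.v ((t : Adele).2 v) ≤ 1 := h1 v
    have h4 : Valued.v (((t⁻¹ : Idele) : Adele).2 v) ≤ 1 := h2 v
    refine le_antisymm h3 ?_
    rw [← h v]
    exact mul_le_of_le_one_right' h4
  · intro h1
    refine ⟨mem_zHat_iff.2 fun v => (h1 v).le, mem_zHat_iff.2 fun v => ?_⟩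
    have := h v
    rw [h1 v, one_mul] at this
    exact this.le

/-! ### Class number one and the fundamental domain. -/

/-- The fundamental domain `ℝ_{>0} × ∏ ℤ_pˣ` for the action of `ℚˣ` on the ideles. -/
def ideleDomain : Set Idele := {t | 0 < infCoord t} ∩ finUnits

theorem valued_principalIdele_mul (q : ℚˣ) (t : Idele) (v : HeightOneSpectrum (𝓞 ℚ)) :
    Valued.v (((principalIdele q * t : Idele) : Adele).2 v) =
      v.valuation ℚ (q : ℚ) * Valued.v ((t : Adele).2 v) := by
  rw [← HeightOneSpectrum.valuedAdicCompletion_eq_valuation', ← map_mul]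
  rfl

theorem infCoord_principalIdele_mul (q : ℚˣ) (t : Idele) :
    infCoord ((principalIdele q * t : Idele) : Adele) = (q : ℚ) * infCoord t := by
  rw [Units.val_mul, infCoord_mul, principalIdele_val, infCoord_algebraMap]

/-- A positive rational with the inverse valuations of t makes every finite component a unit;
multiplying it by -1 if necessary corrects the archimedean sign without changing the valuations. -/
theorem exists_principalIdele_mul_mem (t : Idele) :
    ∃ q : ℚˣ, principalIdele q * t ∈ ideleDomain := by
  obtain ⟨q, hq, hv⟩ := exists_rat_valuation_eq (fun v => (Valued.v ((t : Adele).2 v))⁻¹)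
    (fun v => inv_ne_zero ((map_ne_zero _).2 (finite_coord_ne_zero t v)))
    ((eventually_valued_eq_one t).mono fun v h => by rw [h, inv_one])
  have key : ∀ r : ℚˣ, (∀ v : HeightOneSpectrum (𝓞 ℚ), v.valuation ℚ (r : ℚ) = v.valuation ℚ q) →
      principalIdele r * t ∈ finUnits := by
    intro r hr
    rw [mem_finUnits_iff]
    intro v
    rw [valued_principalIdele_mul, hr, hv,
      inv_mul_cancel₀ ((map_ne_zero _).2 (finite_coord_ne_zero t v))]
  have hq0 : (0 : ℝ) < (q : ℝ) := by exact_mod_cast hq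
  rcases lt_or_gt_of_ne (infCoord_ne_zero t) with h | h
  · refine ⟨-Units.mk0 q hq.ne', ?_, key _ fun v => by simp⟩
    change 0 < infCoord _
    rw [infCoord_principalIdele_mul]
    simpa using mul_neg_of_pos_of_neg hq0 h
  · refine ⟨Units.mk0 q hq.ne', ?_, key _ fun v => by simp⟩
    change 0 < infCoord _
    rw [infCoord_principalIdele_mul]
    exact mul_pos hq0 h

/-- Such a q is a unit at every prime, so q and its inverse are both integers, and q is positive. -/
theorem eq_one_of_principalIdele_mul_mem {q : ℚˣ} {t : Idele} (ht : t ∈ ideleDomain)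
    (hq : principalIdele q * t ∈ ideleDomain) : q = 1 := by
  have h1 := mem_finUnits_iff.1 ht.2
  have h2 := mem_finUnits_iff.1 hq.2
  have hv (v : HeightOneSpectrum (𝓞 ℚ)) : v.valuation ℚ (q : ℚ) = 1 := by
    have := h2 v
    rwa [valued_principalIdele_mul, h1, mul_one] at this
  have hu : principalIdele q ∈ finUnits := by
    rw [mem_finUnits_iff]
    intro v
    rw [← mul_one (principalIdele q), valued_principalIdele_mul, hv, one_mul]
    exact map_one _
  obtain ⟨m, hm⟩ := algebraMap_mem_zHat_iff.1 hu.1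
  have hu2 := hu.2
  rw [← map_inv] at hu2
  obtain ⟨n, hn⟩ := algebraMap_mem_zHat_iff.1 hu2
  have hmn : m * n = 1 := by
    have : (m : ℚ) * n = 1 := by rw [hm, hn, Units.mul_inv]
    exact_mod_cast this
  have hpos : (0 : ℝ) < (q : ℚ) := by
    have h3 : 0 < infCoord ((principalIdele q * t : Idele) : Adele) := hq.1
    rw [infCoord_principalIdele_mul] at h3
    exact pos_of_mul_pos_left h3 (le_of_lt ht.1)
  have hm0 : 0 < m := by
    have : (0 : ℚ) < m := by rw [hm]; exact_mod_cast hpos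
    exact_mod_cast this
  have hm1 : m = 1 := Int.eq_one_of_mul_eq_one_right hm0.le hmn
  exact Units.ext (by rw [← hm, hm1]; simp)

/-! ### The idele norm and the product formula. -/

theorem norm_finite_coord_eq_one_iff (v : HeightOneSpectrum (𝓞 ℚ)) (x : v.adicCompletion ℚ) :
    ‖x‖ = 1 ↔ Valued.v x = 1 := by
  rw [FinitePlace.norm_def, NNReal.coe_eq_one, WithZeroMulInt.toNNReal_eq_one_iff]
  exact (HeightOneSpectrum.one_lt_absNorm_nnreal v).ne'

theorem hasFiniteMulSupport_norm (t : Idele) :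
    (Function.mulSupport fun v : HeightOneSpectrum (𝓞 ℚ) => ‖(t : Adele).2 v‖).Finite :=
  (eventually_valued_eq_one t).mono fun v h => (norm_finite_coord_eq_one_iff v _).2 h

theorem ideleNorm_mul (s t : Idele) : ideleNorm (s * t) = ideleNorm s * ideleNorm t := by
  have h1 : (fun v : HeightOneSpectrum (𝓞 ℚ) => ‖((s * t : Idele) : Adele).2 v‖) =
      fun v => ‖(s : Adele).2 v‖ * ‖(t : Adele).2 v‖ := funext fun v => norm_mul _ _
  rw [ideleNorm, h1, finprod_mul_distrib (hasFiniteMulSupport_norm s) (hasFiniteMulSupport_norm t),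
    norm_fst, Units.val_mul, infCoord_mul, abs_mul, ideleNorm, ideleNorm, norm_fst, norm_fst]
  ring

theorem ideleNorm_principalIdele (q : ℚˣ) : ideleNorm (principalIdele q) = 1 := by
  have h := prod_abs_eq_one (K := ℚ) q.ne_zero
  rw [← finprod_comp_equiv FinitePlace.equivHeightOneSpectrum.symm] at h
  rw [← h, ideleNorm, norm_fst, principalIdele_val, infCoord_algebraMap, Fintype.prod_unique,
    mult_default_infinitePlace, pow_one]
  congr 1
  rw [Subsingleton.elim default Rat.infinitePlace, Rat.infinitePlace_apply]
  exact (Rat.cast_abs _).symm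

theorem ideleNorm_of_mem_finUnits {t : Idele} (ht : t ∈ finUnits) :
    ideleNorm t = |infCoord t| := by
  rw [ideleNorm, norm_fst, finprod_eq_one_of_forall_eq_one, mul_one]
  exact fun v => (norm_finite_coord_eq_one_iff v _).2 (mem_finUnits_iff.1 ht v)

theorem ideleNorm_of_mem_ideleDomain {t : Idele} (ht : t ∈ ideleDomain) :
    ideleNorm t = infCoord t := by
  rw [ideleNorm_of_mem_finUnits ht.2, abs_of_pos ht.1]

/-! ### The measure on the idele class group -/

instance : ideleHaar.IsMulLeftInvariant :=
  inferInstanceAs (Measure.haarMeasure _).IsMulLeftInvariant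

instance : ideleHaar.IsMulRightInvariant := by infer_instance

instance : Countable principalIdeles :=
  have : Countable ℚˣ := Units.val_injective.countable
  (Set.countable_range principalIdele).to_subtype

instance : Countable principalIdeles.op :=
  (principalIdeles.equivOp).symm.injective.countable

theorem continuous_infCoord_idele : Continuous fun t : Idele => infCoord t :=
  continuous_infCoord.comp Units.continuous_val

theorem isOpen_ideleDomain : IsOpen ideleDomain :=
  (isOpen_Ioi.preimage continuous_infCoord_idele).inter
    ((isOpen_zHat.preimage continuous_val_fin).inter
      (isOpen_zHat.preimage (continuous_val_fin.comp continuous_inv)))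

theorem isFundamentalDomain_ideleDomain :
    IsFundamentalDomain principalIdeles.op ideleDomain ideleHaar := by
  refine IsFundamentalDomain.mk' isOpen_ideleDomain.measurableSet.nullMeasurableSet fun t => ?_
  obtain ⟨q, hq⟩ := exists_principalIdele_mul_mem t
  refine ⟨⟨MulOpposite.op (principalIdele q), ⟨q, rfl⟩⟩, ?_, ?_⟩
  · change t * principalIdele q ∈ ideleDomain
    rwa [mul_comm]
  · rintro ⟨g, r, hr⟩ hg
    have hg' : t * MulOpposite.unop g ∈ ideleDomain := hg
    change principalIdele r = MulOpposite.unop g at hr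
    rw [← hr] at hg'
    have h1 : principalIdele (r * q⁻¹) * (principalIdele q * t) ∈ ideleDomain := by
      rw [← mul_assoc, ← map_mul, inv_mul_cancel_right, mul_comm]
      exact hg'
    have h2 := mul_inv_eq_one.1 (eq_one_of_principalIdele_mul_mem hq h1)
    subst h2
    exact Subtype.ext (MulOpposite.unop_injective hr.symm)

/-- On the fundamental domain the norm is the continuous archimedean coordinate, and countably many
translates of the domain cover the ideles. This avoids dealing with the infinite product directly.
-/
theorem measurable_ideleNorm : Measurable ideleNorm := by
  intro B hB
  have : Countable ℚˣ := Units.val_injective.countable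
  have h1 : ideleNorm ⁻¹' B = ⋃ q : ℚˣ, (principalIdele q * ·) ⁻¹'
      (ideleDomain ∩ (fun t : Idele => infCoord t) ⁻¹' B) := by
    ext t
    simp only [Set.mem_preimage, Set.mem_iUnion, Set.mem_inter_iff]
    have h2 (q : ℚˣ) (hq : principalIdele q * t ∈ ideleDomain) :
        infCoord ((principalIdele q * t : Idele) : Adele) = ideleNorm t := by
      rw [← ideleNorm_of_mem_ideleDomain hq, ideleNorm_mul, ideleNorm_principalIdele, one_mul]
    constructor
    · intro ht
      obtain ⟨q, hq⟩ := exists_principalIdele_mul_mem t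
      exact ⟨q, hq, by rwa [h2 q hq]⟩
    · rintro ⟨q, hq, hB'⟩
      rwa [h2 q hq] at hB'
  rw [h1]
  exact MeasurableSet.iUnion fun q => (measurable_const_mul _)
    (isOpen_ideleDomain.measurableSet.inter (continuous_infCoord_idele.measurable hB))

/-- The idele norm on idele classes. -/
def classNorm (q : IdeleClass) : ℝ := ideleNorm q.out

theorem ideleNorm_mul_of_mem {t p : Idele} (hp : p ∈ principalIdeles) :
    ideleNorm (t * p) = ideleNorm t := by
  obtain ⟨q, rfl⟩ := mem_principalIdeles_iff.1 hp
  rw [ideleNorm_mul, ideleNorm_principalIdele, mul_one]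

theorem classNorm_mk (t : Idele) : classNorm (t : IdeleClass) = ideleNorm t := by
  obtain ⟨⟨p, hp⟩, h⟩ := QuotientGroup.mk_out_eq_mul principalIdeles t
  rw [classNorm, h, ideleNorm_mul_of_mem hp]

theorem measurable_classNorm : Measurable classNorm :=
  measurable_from_quotient.2 (by
    have : (classNorm ∘ Quotient.mk'' : Idele → ℝ) = ideleNorm := funext classNorm_mk
    rw [this]
    exact measurable_ideleNorm)

/-- The pushforward of the Haar measure of the fundamental domain by the logarithm of the
archimedean coordinate. -/
def logMeasure : Measure ℝ :=
  (ideleHaar.restrict ideleDomain).map fun t : Idele => Real.log (infCoord t)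

theorem measurable_log_infCoord : Measurable fun t : Idele => Real.log (infCoord t) :=
  Real.measurable_log.comp continuous_infCoord_idele.measurable

theorem infCoord_infIdele (r : ℝˣ) : infCoord (infIdele r) = r :=
  infEquiv.apply_symm_apply _

theorem infIdele_mem_finUnits (r : ℝˣ) : infIdele r ∈ finUnits := ⟨one_mem_zHat, one_mem_zHat⟩

theorem mul_mem_finUnits_iff {s t : Idele} (hs : s ∈ finUnits) :
    s * t ∈ finUnits ↔ t ∈ finUnits := by
  rw [mem_finUnits_iff] at hs
  rw [mem_finUnits_iff, mem_finUnits_iff]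
  refine forall_congr' fun v => ?_
  have : Valued.v (((s * t : Idele) : Adele).2 v) =
      Valued.v ((s : Adele).2 v) * Valued.v ((t : Adele).2 v) := map_mul _ _ _
  rw [this, hs, one_mul]

/-- Translation by a on ℝ lifts to multiplication by the idele with archimedean coordinate exp a and
trivial finite part, which preserves both the Haar measure and the fundamental domain. -/
instance : logMeasure.IsAddLeftInvariant := by
  refine ⟨fun a => ?_⟩
  set g : Idele := infIdele (Units.mk0 (Real.exp a) (Real.exp_ne_zero a)) with hg
  have hinf (t : Idele) : infCoord ((g * t : Idele) : Adele) = Real.exp a * infCoord t := by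
    rw [Units.val_mul, infCoord_mul, hg, infCoord_infIdele, Units.val_mk0]
  have hpre : (g * ·) ⁻¹' ideleDomain = ideleDomain := by
    ext t
    refine and_congr ?_ (mul_mem_finUnits_iff (infIdele_mem_finUnits _))
    change 0 < infCoord ((g * t : Idele) : Adele) ↔ 0 < infCoord t
    rw [hinf, mul_pos_iff_of_pos_left (Real.exp_pos a)]
  have hmp := (measurePreserving_mul_left ideleHaar g).restrict_preimage
    isOpen_ideleDomain.measurableSet
  rw [hpre] at hmp
  rw [logMeasure, Measure.map_map (measurable_const_add a) measurable_log_infCoord]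
  conv_rhs => rw [← hmp.map_eq]
  rw [Measure.map_map measurable_log_infCoord (measurable_const_mul g)]
  refine Measure.map_congr ?_
  filter_upwards [ae_restrict_mem isOpen_ideleDomain.measurableSet] with t ht
  have h0 : infCoord t ≠ 0 := infCoord_ne_zero t
  change a + Real.log (infCoord t) = Real.log (infCoord ((g * t : Idele) : Adele))
  rw [hinf, Real.log_mul (Real.exp_ne_zero a) h0, Real.log_exp]

theorem logMeasure_Icc : logMeasure (Set.Icc 0 1) = 1 := by
  rw [logMeasure, Measure.map_apply measurable_log_infCoord measurableSet_Icc,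
    Measure.restrict_apply (measurable_log_infCoord measurableSet_Icc)]
  have h : (fun t : Idele => Real.log (infCoord t)) ⁻¹' Set.Icc 0 1 ∩ ideleDomain = unitBox := by
    ext t
    constructor
    · rintro ⟨⟨h1, h2⟩, h3, h4⟩
      have h3' : 0 < infCoord t := h3
      refine ⟨⟨?_, ?_⟩, h4⟩
      · exact (Real.log_nonneg_iff h3').1 h1
      · exact (Real.log_le_iff_le_exp h3').1 h2
    · rintro ⟨⟨h1, h2⟩, h4⟩
      have h3 : 0 < infCoord t := zero_lt_one.trans_le h1
      exact ⟨⟨Real.log_nonneg h1, (Real.log_le_iff_le_exp h3).2 h2⟩, h3, h4⟩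
  rw [h]
  exact Measure.haarMeasure_self

/-- Uniqueness of Haar measure on ℝ; the constant is 1 because `unitBox` corresponds to [0, 1] under
the logarithm. -/
theorem logMeasure_eq_volume : logMeasure = volume := by
  have hH : logMeasure.IsAddHaarMeasure :=
    Measure.isAddHaarMeasure_of_isCompact_nonempty_interior logMeasure (Set.Icc 0 1) isCompact_Icc
      (by rw [interior_Icc]; exact Set.nonempty_Ioo.2 zero_lt_one)
      (by rw [logMeasure_Icc]; exact one_ne_zero) (by rw [logMeasure_Icc]; exact ENNReal.one_ne_top)
  have h := Measure.isAddLeftInvariant_eq_smul logMeasure (volume : Measure ℝ)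
  have h2 : logMeasure (Set.Icc 0 1) =
      (Measure.addHaarScalarFactor logMeasure volume • volume : Measure ℝ) (Set.Icc 0 1) := by
    rw [← h]
  rw [logMeasure_Icc, Measure.smul_apply, Real.volume_Icc, sub_zero, ENNReal.ofReal_one] at h2
  have h3 : Measure.addHaarScalarFactor logMeasure volume = 1 := by
    rw [ENNReal.smul_def, smul_eq_mul, mul_one] at h2
    exact_mod_cast h2.symm
  rw [h, h3, one_smul]

/-- The quotient measure is defined through an unspecified fundamental domain. The norm is invariant
under ℚˣ, so its level sets have the same measure in any two domains, and the explicit one may be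
used instead. -/
theorem map_classNorm_ideleClassHaar :
    ideleClassHaar.map classNorm = (volume : Measure ℝ).map Real.exp := by
  have hex : ∃ D : Set Idele, IsFundamentalDomain principalIdeles.op D ideleHaar :=
    ⟨_, isFundamentalDomain_ideleDomain⟩
  have hmk : Measurable (QuotientGroup.mk : Idele → IdeleClass) := measurable_quotient_mk''
  have hcomp : classNorm ∘ (QuotientGroup.mk : Idele → IdeleClass) = ideleNorm :=
    funext classNorm_mk
  rw [ideleClassHaar, quotientMeasure, dif_pos hex, Measure.map_map measurable_classNorm hmk, hcomp]
  have h1 : (ideleHaar.restrict hex.choose).map ideleNorm =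
      (ideleHaar.restrict ideleDomain).map ideleNorm := by
    ext B hB
    rw [Measure.map_apply measurable_ideleNorm hB, Measure.map_apply measurable_ideleNorm hB,
      Measure.restrict_apply (measurable_ideleNorm hB),
      Measure.restrict_apply (measurable_ideleNorm hB)]
    refine hex.choose_spec.measure_set_eq isFundamentalDomain_ideleDomain
      (measurable_ideleNorm hB) fun g => ?_
    ext t
    change ideleNorm (t * MulOpposite.unop g.1) ∈ B ↔ ideleNorm t ∈ B
    rw [ideleNorm_mul_of_mem g.2]
  rw [h1, ← logMeasure_eq_volume, logMeasure,
    Measure.map_map Real.measurable_exp measurable_log_infCoord]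
  refine Measure.map_congr ?_
  filter_upwards [ae_restrict_mem isOpen_ideleDomain.measurableSet] with t ht
  rw [ideleNorm_of_mem_ideleDomain ht]
  exact (Real.exp_log ht.1).symm


/-! ### Integrals over the class group of functions of the norm. -/

theorem measurableEmbedding_exp : MeasurableEmbedding Real.exp :=
  Real.isOpenEmbedding_exp.measurableEmbedding

theorem aestronglyMeasurable_map_exp {f : ℝ → ℂ} (hf : ContinuousOn f (Set.Ioi 0)) :
    AEStronglyMeasurable f (ideleClassHaar.map classNorm) := by
  rw [map_classNorm_ideleClassHaar, measurableEmbedding_exp.aestronglyMeasurable_map_iff]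
  exact (hf.comp_continuous Real.continuous_exp Real.exp_pos).aestronglyMeasurable

theorem image_exp_univ : Real.exp '' Set.univ = Set.Ioi 0 := by
  rw [Set.image_univ, Real.range_exp]

theorem abs_exp_smul_inv_mul (f : ℝ → ℂ) (u : ℝ) :
    |Real.exp u| • ((Real.exp u : ℂ)⁻¹ * f (Real.exp u)) = f (Real.exp u) := by
  rw [abs_of_pos (Real.exp_pos u), Complex.real_smul, ← mul_assoc, mul_inv_cancel₀, one_mul]
  exact_mod_cast Real.exp_ne_zero u

theorem integrable_comp_classNorm_iff {f : ℝ → ℂ} (hf : ContinuousOn f (Set.Ioi 0)) :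
    Integrable (fun q => f (classNorm q)) ideleClassHaar ↔
      IntegrableOn (fun r : ℝ => (r : ℂ)⁻¹ * f r) (Set.Ioi 0) := by
  have h1 := integrable_map_measure (aestronglyMeasurable_map_exp hf)
    measurable_classNorm.aemeasurable
  have h2 := integrableOn_image_iff_integrableOn_abs_deriv_smul MeasurableSet.univ
    (fun x _ => (Real.hasDerivAt_exp x).hasDerivWithinAt) Real.exp_injective.injOn
    (fun r : ℝ => (r : ℂ)⁻¹ * f r)
  simp only [abs_exp_smul_inv_mul, image_exp_univ, integrableOn_univ] at h2
  rw [h2]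
  refine h1.symm.trans ?_
  rw [map_classNorm_ideleClassHaar, measurableEmbedding_exp.integrable_map_iff]
  rfl

/-- The substitution r = exp u turns Lebesgue measure du into dr / r. Continuity on (0, ∞) is
enough, since the pushed-forward measure lives there. -/
theorem integral_comp_classNorm {f : ℝ → ℂ} (hf : ContinuousOn f (Set.Ioi 0)) :
    ∫ q, f (classNorm q) ∂ideleClassHaar = ∫ r in Set.Ioi (0 : ℝ), (r : ℂ)⁻¹ * f r := by
  have h1 := integral_map measurable_classNorm.aemeasurable (aestronglyMeasurable_map_exp hf)
  have h2 := integral_image_eq_integral_abs_deriv_smul MeasurableSet.univ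
    (fun x _ => (Real.hasDerivAt_exp x).hasDerivWithinAt) Real.exp_injective.injOn
    (fun r : ℝ => (r : ℂ)⁻¹ * f r)
  simp only [abs_exp_smul_inv_mul, image_exp_univ, setIntegral_univ] at h2
  rw [h2, ← h1, map_classNorm_ideleClassHaar, measurableEmbedding_exp.integral_map]

/-! ### Gaussian sums over the lattice `ℤ + ℤ z̄` -/

/-- The point `v₁ - v₂ z̄` of the lattice `ℤ + ℤ z̄`. -/
def latticePt (z : ℍ) (v : ℤ × ℤ) : ℂ := (v.1 : ℂ) - v.2 * starRingEnd ℂ (z : ℂ)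

theorem latticePt_eq (z : ℍ) (v : ℤ × ℤ) :
    latticePt z v = (v.1 - v.2 * z.re : ℝ) + (v.2 * z.im : ℝ) * Complex.I := by
  have h : starRingEnd ℂ (z : ℂ) = (z.re : ℂ) - z.im * Complex.I := by
    apply Complex.ext <;> simp
  rw [latticePt, h]
  push_cast
  ring

theorem norm_latticePt_sq (z : ℍ) (v : ℤ × ℤ) :
    ‖latticePt z v‖ ^ 2 = (v.1 - v.2 * z.re) ^ 2 + (v.2 * z.im) ^ 2 := by
  rw [← Complex.normSq_eq_norm_sq, latticePt_eq, Complex.normSq_add_mul_I]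

theorem latticePt_eq_zero_iff {z : ℍ} {v : ℤ × ℤ} : latticePt z v = 0 ↔ v = 0 := by
  constructor
  · intro h
    have h1 := norm_latticePt_sq z v
    rw [h, norm_zero, zero_pow two_ne_zero] at h1
    have h2 : (v.2 * z.im : ℝ) = 0 := by
      nlinarith [sq_nonneg (v.1 - v.2 * z.re : ℝ), sq_nonneg (v.2 * z.im : ℝ)]
    have h3 : (v.2 : ℝ) = 0 := (mul_eq_zero.1 h2).resolve_right z.im_pos.ne'
    have h4 : (v.1 : ℝ) = 0 := by
      rw [h3] at h1
      simpa using h1.symm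
    exact Prod.ext (by exact_mod_cast h4) (by exact_mod_cast h3)
  · rintro rfl
    simp [latticePt]

theorem norm_latticePt (z : ℍ) (v : ℤ × ℤ) :
    ‖latticePt z v‖ = ‖((-v.2 : ℤ) : ℂ) * (z : ℂ) + v.1‖ := by
  rw [← Complex.norm_conj, latticePt]
  congr 1
  simp only [map_sub, map_mul, Complex.conj_conj, map_intCast]
  push_cast
  ring

theorem summable_norm_latticePt_rpow (z : ℍ) {r : ℝ} (hr : 2 < r) :
    Summable fun v : ℤ × ℤ => ‖latticePt z v‖ ^ (-r) := by
  let e : ℤ × ℤ ≃ (Fin 2 → ℤ) :=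
    ((Equiv.prodComm ℤ ℤ).trans ((Equiv.neg ℤ).prodCongr (Equiv.refl ℤ))).trans
      (finTwoArrowEquiv ℤ).symm
  have h1 := (EisensteinSeries.summable_one_div_norm_rpow hr).mul_left
    (EisensteinSeries.r z ^ (-r))
  have h2 : Summable fun x : Fin 2 → ℤ => ‖(x 0 : ℂ) * (z : ℂ) + x 1‖ ^ (-r) :=
    Summable.of_nonneg_of_le (fun x => by positivity)
      (fun x => EisensteinSeries.summand_bound z (by linarith) x) h1
  refine ((e.summable_iff).2 h2).congr fun v => ?_
  rw [norm_latticePt]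
  rfl

theorem summable_exp_latticePt (z : ℍ) {B : ℝ} (hB : 0 < B) (R : ℝ) :
    Summable fun v : ℤ × ℤ => Real.exp (-B * ‖latticePt z v‖ ^ 2 + R * ‖latticePt z v‖) := by
  -- The exponent 3 exceeds the lattice rank 2. The constant combines r³ ≤ 6 exp r with the maximum
  -- of -B r² + (R + 1) r, namely (R + 1)² / (4B).
  have h := (summable_norm_latticePt_rpow z (r := 3) (by norm_num)).mul_left
    (6 * Real.exp ((R + 1) ^ 2 / (4 * B)))
  refine Summable.of_norm_bounded_eventually h ?_
  refine (Set.finite_singleton (0 : ℤ × ℤ)).subset fun v hv => ?_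
  by_contra hv0
  refine hv ?_
  have hr : 0 < ‖latticePt z v‖ :=
    norm_pos_iff.2 fun h0 => hv0 (latticePt_eq_zero_iff.1 h0)
  change ‖Real.exp (-B * ‖latticePt z v‖ ^ 2 + R * ‖latticePt z v‖)‖ ≤
    6 * Real.exp ((R + 1) ^ 2 / (4 * B)) * ‖latticePt z v‖ ^ (-3 : ℝ)
  generalize ‖latticePt z v‖ = r at hr ⊢
  have e1 : r ^ 3 / 6 ≤ Real.exp r := by
    simpa [Nat.factorial] using Real.pow_div_factorial_le_exp r hr.le 3
  have e2 : -B * r ^ 2 + R * r + r ≤ (R + 1) ^ 2 / (4 * B) := by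
    rw [le_div_iff₀ (by positivity)]
    nlinarith [sq_nonneg (2 * B * r - (R + 1))]
  have e3 : r ^ 3 / 6 * Real.exp (-B * r ^ 2 + R * r) ≤ Real.exp ((R + 1) ^ 2 / (4 * B)) :=
    calc r ^ 3 / 6 * Real.exp (-B * r ^ 2 + R * r)
        ≤ Real.exp r * Real.exp (-B * r ^ 2 + R * r) := by gcongr
      _ = Real.exp (-B * r ^ 2 + R * r + r) := by rw [← Real.exp_add, add_comm]
      _ ≤ _ := Real.exp_le_exp.2 e2
  have e4 : r ^ (-3 : ℝ) = (r ^ 3)⁻¹ := by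
    rw [Real.rpow_neg hr.le]
    norm_cast
  rw [Real.norm_of_nonneg (Real.exp_pos _).le, e4, ← div_eq_mul_inv, le_div_iff₀ (by positivity)]
  linarith

/-- The term of index `v` of the generating series of the lattice sums. -/
def genTerm (z : ℍ) (T : ℝ) (w : ℂ) (v : ℤ × ℤ) : ℂ :=
  Complex.exp (-Real.pi * (T / z.im) * (‖latticePt z v‖ : ℂ) ^ 2 + 2 * Real.pi * w * latticePt z v)

theorem norm_sq_cast (z : ℍ) (v : ℤ × ℤ) :
    (‖latticePt z v‖ : ℂ) ^ 2 = (v.1 - v.2 * z.re) ^ 2 + (v.2 * z.im) ^ 2 := by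
  exact_mod_cast congrArg (fun x : ℝ => (x : ℂ)) (norm_latticePt_sq z v)

theorem summable_genTerm (z : ℍ) {T : ℝ} (hT : 0 < T) (w : ℂ) : Summable (genTerm z T w) := by
  have hy := z.im_pos
  refine Summable.of_norm_bounded
    (summable_exp_latticePt z (B := Real.pi * (T / z.im)) (by positivity) (2 * Real.pi * ‖w‖))
    fun v => ?_
  rw [genTerm, Complex.norm_exp, Complex.add_re]
  refine Real.exp_le_exp.2 (add_le_add (le_of_eq ?_) ?_)
  · rw [← Complex.ofReal_div, ← Complex.ofReal_pow, ← Complex.ofReal_neg, ← Complex.ofReal_mul,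
      ← Complex.ofReal_mul, Complex.ofReal_re]
    ring
  · refine (Complex.re_le_norm _).trans (le_of_eq ?_)
    simp [abs_of_pos Real.pi_pos]

/-- These are the norms of the terms of a Jacobi theta series with purely imaginary parameters. -/
theorem summable_exp_int_quadratic {a : ℝ} (ha : 0 < a) (b : ℝ) :
    Summable fun n : ℤ => Real.exp (-a * n ^ 2 + b * n) := by
  have h := ((summable_jacobiTheta₂_term_iff (-Complex.I * (b / (2 * Real.pi) : ℝ))
    (Complex.I * (a / Real.pi : ℝ))).2 (by simp; positivity)).norm
  refine h.congr fun n => ?_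
  rw [norm_jacobiTheta₂_term]
  have hpi := Real.pi_ne_zero
  have e : ((b : ℂ) / (2 * Real.pi)).re = b / (2 * Real.pi) := by
    rw [← Complex.ofReal_re (b / (2 * Real.pi))]
    push_cast
    rfl
  congr 1
  simp [e]
  field_simp

/-- The lattice sum transformed by Poisson summation in the first variable. -/
def midTerm (z : ℍ) (A : ℝ) (w : ℂ) (m n : ℤ) : ℂ :=
  Complex.exp (-Real.pi * (A * z.im ^ 2) * n ^ 2 +
    2 * Real.pi * (Complex.I * (w * z.im - m * z.re)) * n +
    (-Real.pi / A * m ^ 2 - 2 * Real.pi * Complex.I * m * w / A + Real.pi * w ^ 2 / A))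

/-- The only term mixing m and n in the exponent is purely imaginary, so the norm is a constant
times a product of two one-variable Gaussians. -/
theorem summable_midTerm (z : ℍ) {A : ℝ} (hA : 0 < A) (w : ℂ) :
    Summable fun v : ℤ × ℤ => midTerm z A w v.1 v.2 := by
  have hy := z.im_pos
  have h1 := summable_exp_int_quadratic (a := Real.pi / A) (by positivity)
    (2 * Real.pi * w.im / A)
  have h2 := summable_exp_int_quadratic (a := Real.pi * (A * z.im ^ 2)) (by positivity)
    (-2 * Real.pi * z.im * w.im)
  have h3 := (h1.mul_of_nonneg h2 (fun _ => (Real.exp_pos _).le)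
    (fun _ => (Real.exp_pos _).le)).mul_left (Real.exp (Real.pi * w ^ 2 / A).re)
  refine Summable.of_norm (h3.congr fun v => ?_)
  rw [midTerm, Complex.norm_exp, ← Real.exp_add, ← Real.exp_add]
  congr 1
  have e : ∀ x : ℂ, ∀ r : ℝ, (x / r).re = x.re / r := fun x r => Complex.div_ofReal_re x r
  simp [e, pow_two]
  ring

/-- For fixed n the exponent is a quadratic polynomial in m; Poisson summation applies once the part
independent of m is factored out. -/
theorem tsum_genTerm_fst (z : ℍ) {T : ℝ} (hT : 0 < T) (w : ℂ) (n : ℤ) :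
    ∑' m : ℤ, genTerm z T w (m, n) =
      1 / ((T / z.im : ℝ) : ℂ) ^ (1 / 2 : ℂ) * ∑' m : ℤ, midTerm z (T / z.im) w m n := by
  have hy := z.im_pos
  set A : ℝ := T / z.im with hA
  have hA0 : 0 < A := by positivity
  have hAc : (A : ℂ) ≠ 0 := by exact_mod_cast hA0.ne'
  have hP := Complex.tsum_exp_neg_quadratic (a := (A : ℂ)) (by simpa using hA0)
    (A * n * z.re + w)
  have h1 : ∀ m : ℤ, genTerm z T w (m, n) =
      Complex.exp (-Real.pi * A * m ^ 2 + 2 * Real.pi * (A * n * z.re + w) * m) *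
        Complex.exp (-Real.pi * A * (n ^ 2 * (z.re ^ 2 + z.im ^ 2)) -
          2 * Real.pi * w * n * (z.re - z.im * Complex.I)) := by
    intro m
    rw [genTerm, ← Complex.exp_add, norm_sq_cast, latticePt_eq, hA]
    push_cast
    congr 1
    ring
  have h2 : ∀ m : ℤ, midTerm z A w m n =
      Complex.exp (-Real.pi / A * (m + Complex.I * (A * n * z.re + w)) ^ 2) *
        Complex.exp (-Real.pi * A * (n ^ 2 * (z.re ^ 2 + z.im ^ 2)) -
          2 * Real.pi * w * n * (z.re - z.im * Complex.I)) := by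
    intro m
    rw [midTerm, ← Complex.exp_add]
    congr 1
    field_simp
    ring_nf
    simp only [Complex.I_sq]
    ring
  simp_rw [h1, h2, tsum_mul_right]
  rw [hP, mul_assoc]

/-- The second Poisson summation, now in n. Completing the square cancels the w² term left by the
first one, and what remains is again a generating series, at T⁻¹ and w / T. -/
theorem tsum_midTerm_snd (z : ℍ) {T : ℝ} (hT : 0 < T) (w : ℂ) (m : ℤ) :
    ∑' n : ℤ, midTerm z (T / z.im) w m n =
      1 / ((T * z.im : ℝ) : ℂ) ^ (1 / 2 : ℂ) * ∑' n : ℤ, genTerm z T⁻¹ (w / T) (n, -m) := by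
  have hy := z.im_pos
  have hT' : (T : ℂ) ≠ 0 := by exact_mod_cast hT.ne'
  have hy' : (z.im : ℂ) ≠ 0 := by exact_mod_cast hy.ne'
  have hP := Complex.tsum_exp_neg_quadratic (a := ((T * z.im : ℝ) : ℂ))
    (by rw [Complex.ofReal_re]; positivity) (Complex.I * (w * z.im - m * z.re))
  have h1 : ∀ n : ℤ, midTerm z (T / z.im) w m n =
      Complex.exp (-Real.pi * ((T * z.im : ℝ) : ℂ) * n ^ 2 +
          2 * Real.pi * (Complex.I * (w * z.im - m * z.re)) * n) *
        Complex.exp (-Real.pi * z.im / T * m ^ 2 - 2 * Real.pi * Complex.I * m * w * z.im / T +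
          Real.pi * w ^ 2 * z.im / T) := by
    intro n
    rw [midTerm, ← Complex.exp_add]
    push_cast
    congr 1
    field_simp
  have h2 : ∀ n : ℤ, genTerm z T⁻¹ (w / T) (n, -m) =
      Complex.exp (-Real.pi / ((T * z.im : ℝ) : ℂ) *
          (n + Complex.I * (Complex.I * (w * z.im - m * z.re))) ^ 2) *
        Complex.exp (-Real.pi * z.im / T * m ^ 2 - 2 * Real.pi * Complex.I * m * w * z.im / T +
          Real.pi * w ^ 2 * z.im / T) := by
    intro n
    rw [genTerm, ← Complex.exp_add, norm_sq_cast, latticePt_eq, ← mul_assoc Complex.I,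
      Complex.I_mul_I]
    push_cast
    congr 1
    field_simp
    ring
  simp_rw [h1, h2, tsum_mul_right]
  rw [hP, mul_assoc]

/-- The functional equation of the generating series. -/
theorem tsum_genTerm (z : ℍ) {T : ℝ} (hT : 0 < T) (w : ℂ) :
    ∑' v, genTerm z T w v = (T : ℂ)⁻¹ * ∑' v, genTerm z T⁻¹ (w / T) v := by
  have hy := z.im_pos
  have h1 := summable_genTerm z hT w
  have h2 := summable_genTerm z (inv_pos.2 hT) (w / T)
  have hm := summable_midTerm z (A := T / z.im) (by positivity) w
  have e1 : ∑' v, genTerm z T w v = ∑' (n : ℤ) (m : ℤ), genTerm z T w (m, n) := by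
    rw [← (Equiv.prodComm ℤ ℤ).tsum_eq]
    exact ((Equiv.prodComm ℤ ℤ).summable_iff.2 h1).tsum_prod
  have e2 : ∑' v, genTerm z T⁻¹ (w / T) v =
      ∑' (m : ℤ) (n : ℤ), genTerm z T⁻¹ (w / T) (n, -m) := by
    rw [← (Equiv.prodComm ℤ ℤ).tsum_eq]
    refine ((Equiv.prodComm ℤ ℤ).summable_iff.2 h2).tsum_prod.trans ?_
    rw [← (Equiv.neg ℤ).tsum_eq]
    rfl
  -- The two Poisson summations run over different variables, so the intermediate double sum must be
  -- reordered; this is where its joint summability is needed.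
  have e3 : ∑' (n : ℤ) (m : ℤ), midTerm z (T / z.im) w m n =
      ∑' (m : ℤ) (n : ℤ), midTerm z (T / z.im) w m n := Summable.tsum_comm hm
  rw [e1, e2]
  simp_rw [tsum_genTerm_fst z hT w]
  rw [tsum_mul_left, e3]
  simp_rw [tsum_midTerm_snd z hT w]
  rw [tsum_mul_left, ← mul_assoc]
  congr 1
  -- The two Poisson factors (T/y)^{-1/2} and (Ty)^{-1/2} multiply to 1/T.
  have hc : ∀ a : ℝ, 0 < a → (a : ℂ) ^ (1 / 2 : ℂ) = (√a : ℝ) := by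
    intro a ha
    rw [Real.sqrt_eq_rpow, Complex.ofReal_cpow ha.le]
    norm_num
  rw [hc _ (by positivity), hc _ (by positivity)]
  rw [one_div, one_div, ← mul_inv, ← Complex.ofReal_mul, ← Real.sqrt_mul (by positivity)]
  have : T / z.im * (T * z.im) = T ^ 2 := by field_simp
  rw [this, Real.sqrt_sq hT.le]

/-! ### Moments of exponential series -/

section Moments

variable {ι : Type*} {c a : ι → ℂ}

/-- Since ‖a‖^k ≤ k! exp ‖a‖, a power of a costs only an increase of R by one, so one exponential
hypothesis controls all moments. -/
theorem norm_mul_pow_mul_exp_le (c a w : ℂ) (k : ℕ) {R : ℝ} (hw : ‖w‖ ≤ R) :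
    ‖c * a ^ k * Complex.exp (w * a)‖ ≤ k.factorial * (‖c‖ * Real.exp ((R + 1) * ‖a‖)) := by
  have h1 : ‖a‖ ^ k ≤ k.factorial * Real.exp ‖a‖ := by
    have := Real.pow_div_factorial_le_exp ‖a‖ (norm_nonneg a) k
    rwa [div_le_iff₀ (by positivity), mul_comm] at this
  have h2 : ‖Complex.exp (w * a)‖ ≤ Real.exp (R * ‖a‖) := by
    rw [Complex.norm_exp]
    refine Real.exp_le_exp.2 ((Complex.re_le_norm _).trans ?_)
    rw [norm_mul]
    gcongr
  rw [norm_mul, norm_mul, norm_pow, add_mul, one_mul, Real.exp_add]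
  calc ‖c‖ * ‖a‖ ^ k * ‖Complex.exp (w * a)‖
      ≤ ‖c‖ * (k.factorial * Real.exp ‖a‖) * Real.exp (R * ‖a‖) := by gcongr
    _ = _ := by ring

theorem summable_moment (h : ∀ R : ℝ, Summable fun i => ‖c i‖ * Real.exp (R * ‖a i‖)) (k : ℕ)
    (w : ℂ) : Summable fun i => c i * a i ^ k * Complex.exp (w * a i) :=
  Summable.of_norm_bounded ((h (‖w‖ + 1)).mul_left _) fun i =>
    norm_mul_pow_mul_exp_le (c i) (a i) w k le_rfl

theorem hasDerivAt_tsum_moment (h : ∀ R : ℝ, Summable fun i => ‖c i‖ * Real.exp (R * ‖a i‖))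
    (k : ℕ) (w : ℂ) : HasDerivAt (fun w => ∑' i, c i * a i ^ k * Complex.exp (w * a i))
      (∑' i, c i * a i ^ (k + 1) * Complex.exp (w * a i)) w := by
  refine hasDerivAt_tsum_of_isPreconnected (t := Metric.ball 0 (‖w‖ + 1))
    (g := fun i w => c i * a i ^ k * Complex.exp (w * a i))
    (g' := fun i w => c i * a i ^ (k + 1) * Complex.exp (w * a i))
    ((h (‖w‖ + 1 + 1)).mul_left ((k + 1).factorial : ℝ)) Metric.isOpen_ball
    (convex_ball _ _).isPreconnected ?_ ?_ (y₀ := w) (by simp) (summable_moment h k w) (by simp)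
  · intro i u _
    convert! (((hasDerivAt_id u).mul_const (a i)).cexp.const_mul (c i * a i ^ k)) using 1
    simp only [id]
    ring
  · intro i u hu
    exact norm_mul_pow_mul_exp_le _ _ _ _ (mem_ball_zero_iff.1 hu).le

/-- An identity between two exponential series implies the same identity between their moments. -/
theorem tsum_moment_eq {ι' : Type*} {c' a' : ι' → ℂ}
    (h : ∀ R : ℝ, Summable fun i => ‖c i‖ * Real.exp (R * ‖a i‖))
    (h' : ∀ R : ℝ, Summable fun i => ‖c' i‖ * Real.exp (R * ‖a' i‖)) {b l : ℂ}
    (heq : ∀ w : ℂ, ∑' i, c i * Complex.exp (w * a i) =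
      b * ∑' i, c' i * Complex.exp ((l * w) * a' i)) (k : ℕ) (w : ℂ) :
    ∑' i, c i * a i ^ k * Complex.exp (w * a i) =
      b * l ^ k * ∑' i, c' i * a' i ^ k * Complex.exp ((l * w) * a' i) := by
  -- Each step differentiates the identity in w; the chain rule supplies one more factor l.
  induction k generalizing w with
  | zero => simpa using heq w
  | succ k ih =>
    have h1 := hasDerivAt_tsum_moment h k w
    have h2 := (((hasDerivAt_tsum_moment h' k (l * w)).comp w
      ((hasDerivAt_id w).const_mul l)).const_mul (b * l ^ k))
    have h3 : (fun w => ∑' i, c i * a i ^ k * Complex.exp (w * a i)) = fun w =>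
        b * l ^ k * ((fun w => ∑' i, c' i * a' i ^ k * Complex.exp (w * a' i)) ∘
          fun w => l * w) w := funext ih
    rw [h3] at h1
    rw [h1.unique h2]
    ring

end Moments

/-! ### The theta series of weight `k` -/

/-- The series `∑_v (v₁ - v₂ z̄)^k exp (-π T |v₁ - v₂ z̄|² / y)`. -/
def latticeTheta (z : ℍ) (k : ℕ) (T : ℝ) : ℂ :=
  ∑' v, latticePt z v ^ k * (Real.exp (-(Real.pi * ‖latticePt z v‖ ^ 2 / z.im) * T) : ℂ)

theorem summable_exp_mul_exp (z : ℍ) {T : ℝ} (hT : 0 < T) (R : ℝ) :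
    Summable fun v => ‖(Real.exp (-(Real.pi * ‖latticePt z v‖ ^ 2 / z.im) * T) : ℂ)‖ *
      Real.exp (R * ‖2 * Real.pi * latticePt z v‖) := by
  have hy := z.im_pos
  refine (summable_exp_latticePt z (B := Real.pi * (T / z.im)) (by positivity)
    (R * (2 * Real.pi))).congr fun v => ?_
  rw [Complex.norm_real, Real.norm_of_nonneg (Real.exp_pos _).le, ← Real.exp_add, norm_mul,
    norm_mul, Complex.norm_real, Real.norm_of_nonneg Real.pi_pos.le, Complex.norm_two]
  congr 1
  ring

theorem summable_latticeTheta (z : ℍ) (k : ℕ) {T : ℝ} (hT : 0 < T) :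
    Summable fun v =>
      latticePt z v ^ k * (Real.exp (-(Real.pi * ‖latticePt z v‖ ^ 2 / z.im) * T) : ℂ) := by
  have h := (summable_moment (summable_exp_mul_exp z hT) k 0).mul_left ((2 * Real.pi : ℂ) ^ k)⁻¹
  refine h.congr fun v => ?_
  have : (2 * Real.pi : ℂ) ^ k ≠ 0 := by simp [Real.pi_ne_zero]
  rw [zero_mul, Complex.exp_zero, mul_one, mul_pow (2 * Real.pi : ℂ)]
  field_simp

theorem genTerm_eq (z : ℍ) (T : ℝ) (w : ℂ) (v : ℤ × ℤ) :
    genTerm z T w v = (Real.exp (-(Real.pi * ‖latticePt z v‖ ^ 2 / z.im) * T) : ℂ) *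
      Complex.exp (w * (2 * Real.pi * latticePt z v)) := by
  rw [genTerm, Complex.exp_add]
  push_cast
  congr 2 <;> ring

/-- The k-th moment at w = 0 of the identity for the generating series: one factor 1/T comes from
Poisson summation and k more from the rescaling of w. -/
theorem latticeTheta_functional_equation (z : ℍ) (k : ℕ) {T : ℝ} (hT : 0 < T) :
    latticeTheta z k T = (T : ℂ)⁻¹ ^ (k + 1) * latticeTheta z k T⁻¹ := by
  have h := tsum_moment_eq (summable_exp_mul_exp z hT) (summable_exp_mul_exp z (inv_pos.2 hT))
    (b := (T : ℂ)⁻¹) (l := (T : ℂ)⁻¹) (fun w => by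
      simp_rw [← genTerm_eq]
      rw [tsum_genTerm z hT w, div_eq_inv_mul]) k 0
  have e : ∀ T : ℝ, ∑' v, (Real.exp (-(Real.pi * ‖latticePt z v‖ ^ 2 / z.im) * T) : ℂ) *
      (2 * Real.pi * latticePt z v) ^ k = (2 * Real.pi) ^ k * latticeTheta z k T := by
    intro T
    rw [latticeTheta, ← tsum_mul_left]
    refine tsum_congr fun v => ?_
    rw [mul_pow]
    ring
  have hpi : (2 * Real.pi : ℂ) ^ k ≠ 0 := by simp [Real.pi_ne_zero]
  simp only [mul_zero, zero_mul, Complex.exp_zero, mul_one] at h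
  rw [e, e] at h
  refine mul_left_cancel₀ hpi (h.trans ?_)
  ring

/-! ### Growth and Mellin transform of the theta series. -/

theorem le_norm_latticePt_sq (z : ℍ) {v : ℤ × ℤ} (hv : v ≠ 0) :
    min 1 (z.im ^ 2) ≤ ‖latticePt z v‖ ^ 2 := by
  have hi : ∀ n : ℤ, n ≠ 0 → (1 : ℝ) ≤ (n : ℝ) ^ 2 := by
    intro n hn
    have : 1 ≤ n ^ 2 := by
      have := sq_pos_of_ne_zero hn
      omega
    exact_mod_cast this
  rw [norm_latticePt_sq]
  by_cases h2 : v.2 = 0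
  · have h1 : v.1 ≠ 0 := fun h1 => hv (Prod.ext h1 h2)
    rw [h2]
    simpa using Or.inl (hi _ h1)
  · refine (min_le_right _ _).trans ?_
    nlinarith [sq_nonneg (v.1 - v.2 * z.re : ℝ), hi _ h2, sq_nonneg z.im]

/-- Each term is compared with its value at T = 1: if c ≥ b and T ≥ 1 then exp(-cT) ≤ exp(-c) exp(b)
exp(-bT). The zero vector, which has no such gap, drops out because k ≠ 0. -/
theorem exists_norm_latticeTheta_le (z : ℍ) {k : ℕ} (hk : k ≠ 0) :
    ∃ b > 0, ∃ C : ℝ, ∀ T, 1 ≤ T → ‖latticeTheta z k T‖ ≤ C * Real.exp (-b * T) := by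
  have hy := z.im_pos
  have hδ : 0 < min 1 (z.im ^ 2) := by positivity
  set b := Real.pi * min 1 (z.im ^ 2) / z.im with hb
  have hb0 : 0 < b := by positivity
  refine ⟨b, hb0, (∑' v, ‖latticePt z v ^ k *
    (Real.exp (-(Real.pi * ‖latticePt z v‖ ^ 2 / z.im) * 1) : ℂ)‖) * Real.exp b, fun T hT => ?_⟩
  have hs := (summable_latticeTheta z k one_pos).norm
  rw [mul_assoc, ← Real.exp_add, ← tsum_mul_right]
  refine tsum_of_norm_bounded (hs.mul_right _).hasSum fun v => ?_
  rw [norm_mul, norm_mul, Complex.norm_real, Complex.norm_real,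
    Real.norm_of_nonneg (Real.exp_pos _).le, Real.norm_of_nonneg (Real.exp_pos _).le, mul_assoc]
  by_cases hv : v = 0
  · rw [latticePt_eq_zero_iff.2 hv, zero_pow hk]
    simp
  · refine mul_le_mul_of_nonneg_left ?_ (norm_nonneg _)
    rw [← Real.exp_add]
    refine Real.exp_le_exp.2 ?_
    have h1 : b ≤ Real.pi * ‖latticePt z v‖ ^ 2 / z.im := by
      rw [hb]
      gcongr
      exact le_norm_latticePt_sq z hv
    nlinarith

theorem latticeTheta_isBigO_atTop (z : ℍ) {k : ℕ} (hk : k ≠ 0) (a : ℝ) :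
    latticeTheta z k =O[atTop] fun T : ℝ => T ^ (-a) := by
  obtain ⟨b, hb, C, h⟩ := exists_norm_latticeTheta_le z hk
  have h1 : latticeTheta z k =O[atTop] fun T : ℝ => Real.exp (-b * T) :=
    Asymptotics.IsBigO.of_bound C (by
      filter_upwards [eventually_ge_atTop 1] with T hT
      rw [Real.norm_of_nonneg (Real.exp_pos _).le]
      exact h T hT)
  exact h1.trans (isLittleO_exp_neg_mul_rpow_atTop hb _).isBigO

/-- The functional equation costs T^{-(k+1)}, compensated by decay of order k + 1 at infinity.
Boundedness is all that is needed for convergence on Re s > 0. -/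
theorem latticeTheta_isBigO_zero (z : ℍ) {k : ℕ} (hk : k ≠ 0) :
    latticeTheta z k =O[𝓝[>] 0] fun T : ℝ => T ^ (-(0 : ℝ)) := by
  have h1 := (latticeTheta_isBigO_atTop z hk (k + 1)).comp_tendsto
    (tendsto_inv_nhdsGT_zero (𝕜 := ℝ))
  obtain ⟨C, hC⟩ := h1.bound
  refine Asymptotics.IsBigO.of_bound C ?_
  filter_upwards [hC, self_mem_nhdsWithin] with T hT hT0
  have hT0' : 0 < T := hT0
  rw [latticeTheta_functional_equation z k hT0', norm_mul, norm_pow, norm_inv, Complex.norm_real,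
    Real.norm_of_nonneg hT0'.le, neg_zero, Real.rpow_zero, norm_one, mul_one]
  have e : ‖((fun T : ℝ => T ^ (-((k : ℝ) + 1))) ∘ fun x : ℝ => x⁻¹) T‖ = T ^ (k + 1) := by
    rw [Function.comp_apply, Real.inv_rpow hT0'.le, ← Real.rpow_neg hT0'.le, neg_neg,
      Real.norm_of_nonneg (by positivity)]
    exact_mod_cast Real.rpow_natCast T (k + 1)
  rw [e] at hT
  calc T⁻¹ ^ (k + 1) * ‖latticeTheta z k T⁻¹‖
      ≤ T⁻¹ ^ (k + 1) * (C * T ^ (k + 1)) := by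
        gcongr
        exact hT
    _ = C := by
      rw [inv_pow]
      field_simp

theorem continuousOn_latticeTheta (z : ℍ) (k : ℕ) :
    ContinuousOn (latticeTheta z k) (Set.Ioi 0) := by
  have hy := z.im_pos
  intro T (hT : 0 < T)
  have h : ContinuousOn (latticeTheta z k) (Set.Ioi (T / 2)) := by
    refine continuousOn_tsum (fun v => by fun_prop)
      (summable_latticeTheta z k (half_pos hT)).norm fun v x hx => ?_
    rw [norm_mul, norm_mul, Complex.norm_real, Complex.norm_real,
      Real.norm_of_nonneg (Real.exp_pos _).le, Real.norm_of_nonneg (Real.exp_pos _).le]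
    refine mul_le_mul_of_nonneg_left (Real.exp_le_exp.2 ?_) (norm_nonneg _)
    have h1 : 0 ≤ Real.pi * ‖latticePt z v‖ ^ 2 / z.im := by positivity
    have hx' : T / 2 ≤ x := le_of_lt hx
    nlinarith
  exact (h.continuousAt (Ioi_mem_nhds (by linarith))).continuousWithinAt

theorem mellinConvergent_latticeTheta (z : ℍ) {k : ℕ} (hk : k ≠ 0) {s : ℂ} (hs : 0 < s.re) :
    MellinConvergent (latticeTheta z k) s :=
  mellinConvergent_of_isBigO_rpow
    ((continuousOn_latticeTheta z k).locallyIntegrableOn measurableSet_Ioi)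
    (latticeTheta_isBigO_atTop z hk (s.re + 1)) (lt_add_one _) (latticeTheta_isBigO_zero z hk) hs

theorem differentiableAt_mellin_latticeTheta (z : ℍ) {k : ℕ} (hk : k ≠ 0) {s : ℂ}
    (hs : 0 < s.re) : DifferentiableAt ℂ (mellin (latticeTheta z k)) s :=
  mellin_differentiableAt_of_isBigO_rpow
    ((continuousOn_latticeTheta z k).locallyIntegrableOn measurableSet_Ioi)
    (latticeTheta_isBigO_atTop z hk (s.re + 1)) (lt_add_one _) (latticeTheta_isBigO_zero z hk) hs

/-- Each exponential integrates to a Gamma factor. The interchange requires ∑ |P|^{k - 2 Re s} to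
converge over a lattice of rank 2, whence the bound k/2 + 1. -/
theorem hasSum_mellin_latticeTheta (z : ℍ) {k : ℕ} (hk : k ≠ 0) {s : ℂ}
    (hs : (k : ℝ) / 2 + 1 < s.re) :
    HasSum (fun v => Complex.Gamma s * latticePt z v ^ k /
      ((Real.pi * ‖latticePt z v‖ ^ 2 / z.im : ℝ) : ℂ) ^ s) (mellin (latticeTheta z k) s) := by
  have hy := z.im_pos
  have hs0 : 0 < s.re := lt_of_le_of_lt (by positivity) hs
  refine hasSum_mellin (fun v => ?_) hs0 (fun T hT => (summable_latticeTheta z k hT).hasSum) ?_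
  · by_cases hv : latticePt z v = 0
    · exact Or.inl (by rw [hv, zero_pow hk])
    · have := norm_pos_iff.2 hv
      exact Or.inr (by positivity)
  · have h1 := (summable_norm_latticePt_rpow z (r := 2 * s.re - k) (by linarith)).mul_left
      ((Real.pi / z.im) ^ s.re)⁻¹
    refine h1.congr fun v => ?_
    by_cases hv : latticePt z v = 0
    · have h2 : (k : ℝ) - 2 * s.re ≠ 0 := by linarith
      rw [hv, zero_pow hk]
      simp [Real.zero_rpow h2]
    · have hr := norm_pos_iff.2 hv
      rw [norm_pow]
      generalize ‖latticePt z v‖ = r at hr ⊢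
      rw [show Real.pi * r ^ 2 / z.im = Real.pi / z.im * r ^ 2 by ring,
        Real.mul_rpow (by positivity) (by positivity), ← Real.rpow_natCast r k,
        ← Real.rpow_natCast r 2, ← Real.rpow_mul hr.le, neg_sub, Real.rpow_sub hr, Nat.cast_ofNat]
      field_simp

/-! ### The adelic theta series -/

theorem infCoord_mkAdele (r : ℝ) (b : FinAdele) : infCoord (mkAdele r b) = r :=
  infEquiv.apply_symm_apply r

/-- The finite part as a ring homomorphism. -/
def finPartHom : Adele →+* FinAdele := RingHom.snd (InfiniteAdeleRing ℚ) FinAdele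

theorem infMatrix_mulVec_snd (N : Matrix (Fin 2) (Fin 2) ℝ) (u : Fin 2 → Adele) (i : Fin 2) :
    ((infMatrix N).mulVec u i).2 = (u i).2 := by
  have h : ((infMatrix N).mulVec u i).2 =
      ∑ j, (1 : Matrix (Fin 2) (Fin 2) FinAdele) i j * (u j).2 :=
    (map_sum finPartHom (fun j => infMatrix N i j * u j) Finset.univ).trans
      (Finset.sum_congr rfl fun j _ => rfl)
  rw [h]
  exact congrFun (Matrix.one_mulVec fun j => (u j).2) i

theorem infCoord_infMatrix_mulVec (N : Matrix (Fin 2) (Fin 2) ℝ) (u : Fin 2 → Adele) (i : Fin 2) :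
    infCoord ((infMatrix N).mulVec u i) = N.mulVec (fun j => infCoord (u j)) i := by
  change infCoordHom (∑ j, infMatrix N i j * u j) = ∑ j, N i j * infCoord (u j)
  rw [map_sum]
  refine Finset.sum_congr rfl fun j _ => ?_
  rw [map_mul]
  exact congrArg (· * infCoord (u j)) (infCoord_mkAdele _ ((1 : Matrix (Fin 2) (Fin 2) FinAdele) i j))

/-- The inverse of g / t is t g⁻¹, so dividing the matrix by t multiplies the vector by t. -/
theorem divIdele_inv_mulVec (M : GL (Fin 2) ℝ) (t : Idele) (u : Fin 2 → Adele) :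
    ((divIdele (infGL M) t)⁻¹ : GL (Fin 2) Adele).1.mulVec u =
      (infMatrix (M⁻¹ : GL (Fin 2) ℝ)).mulVec fun i => t * u i := by
  have h : ((divIdele (infGL M) t)⁻¹ : GL (Fin 2) Adele).1 =
      infMatrix (M⁻¹ : GL (Fin 2) ℝ) * Matrix.diagonal fun _ => (t : Adele) := by
    rw [divIdele, mul_inv_rev, ← map_inv, inv_inv]
    rfl
  rw [h, ← Matrix.mulVec_mulVec]
  congr 1
  ext1 i
  exact Matrix.mulVec_diagonal _ _ _

theorem realMatrix_inv_mulVec (z : ℍ) (u : Fin 2 → ℝ) :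
    ((realMatrix z)⁻¹ : GL (Fin 2) ℝ).1.mulVec u =
      ![(√z.im)⁻¹ * (u 0 - z.re * u 1), (√z.im)⁻¹ * (z.im * u 1)] := by
  have hy : √z.im ≠ 0 := (Real.sqrt_pos.2 z.im_pos).ne'
  have hyy : √z.im * √z.im = z.im := Real.mul_self_sqrt z.im_pos.le
  have h : u = (realMatrix z).1.mulVec
      ![(√z.im)⁻¹ * (u 0 - z.re * u 1), (√z.im)⁻¹ * (z.im * u 1)] := by
    have hM : (realMatrix z).1 = !![√z.im, z.re * (√z.im)⁻¹; 0, (√z.im)⁻¹] := by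
      simp [realMatrix, Matrix.GeneralLinearGroup.mkOfDetNeZero]
    rw [hM]
    ext i
    fin_cases i
    · simp [Matrix.mulVec, dotProduct, Fin.sum_univ_two]
      field_simp
      rw [pow_two, hyy]
      field_simp
      ring
    · simp [Matrix.mulVec, dotProduct, Fin.sum_univ_two]
      field_simp
      rw [pow_two, hyy]
  conv_lhs => rw [h]
  rw [Matrix.mulVec_mulVec]
  have : ((realMatrix z)⁻¹ : GL (Fin 2) ℝ).1 * (realMatrix z).1 = 1 := Units.inv_mul _
  rw [this, Matrix.one_mulVec]

theorem phi_mulVec (k : ℕ) (z : ℍ) (u : Fin 2 → Adele) :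
    phi k ((infMatrix ((realMatrix z)⁻¹ : GL (Fin 2) ℝ)).mulVec u) =
      phiFin (fun i => (u i).2) * phiInf k ![(√z.im)⁻¹ * (infCoord (u 0) - z.re * infCoord (u 1)),
        (√z.im)⁻¹ * (z.im * infCoord (u 1))] := by
  rw [phi]
  congr 2
  · exact funext fun i => infMatrix_mulVec_snd _ u i
  · rw [← realMatrix_inv_mulVec z fun i => infCoord (u i)]
    exact funext fun i => infCoord_infMatrix_mulVec _ u i

theorem thetaTerm_eq (k : ℕ) (z : ℍ) (t : Idele) (v : {v : Fin 2 → ℚ // v ≠ 0}) :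
    thetaTerm (phi k) (divIdele (gMat z) t) v =
      phi k ((infMatrix ((realMatrix z)⁻¹ : GL (Fin 2) ℝ)).mulVec
        fun i => t * algebraMap ℚ Adele (v.1 i)) := by
  rw [thetaTerm, act, gMat, divIdele_inv_mulVec]

theorem mul_mem_zHat {x y : FinAdele} (hx : x ∈ zHat) (hy : y ∈ zHat) : x * y ∈ zHat :=
  fun v => (v.adicCompletionIntegers ℚ).mul_mem _ _ (hx v) (hy v)

theorem finUnits_mul_mem_zHat_iff {t : Idele} (ht : t ∈ finUnits) (x : Adele) :
    (t * x : Adele).2 ∈ zHat ↔ x.2 ∈ zHat := by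
  refine ⟨fun h => ?_, fun h => mul_mem_zHat ht.1 h⟩
  have h1 : (((t⁻¹ : Idele) : Adele) * (t * x)).2 ∈ zHat := mul_mem_zHat ht.2 h
  rwa [Units.inv_mul_cancel_left] at h1

/-- The inclusion of the nonzero integral vectors in the nonzero rational vectors. -/
def intVec (v : {v : ℤ × ℤ // v ≠ 0}) : {v : Fin 2 → ℚ // v ≠ 0} :=
  ⟨![(v.1.1 : ℚ), (v.1.2 : ℚ)], fun h => v.2 (Prod.ext
    (by simpa using congrFun h 0) (by simpa using congrFun h 1))⟩

theorem intVec_injective : Function.Injective intVec := by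
  intro v w h
  have h' := congrArg Subtype.val h
  refine Subtype.ext (Prod.ext ?_ ?_)
  · simpa [intVec] using congrFun h' 0
  · simpa [intVec] using congrFun h' 1

/-- Viewed as a complex number, g_z⁻¹ v is y^{-1/2} (v₁ - v₂ z̄); this is the origin of z̄ in the
explicit formula. -/
theorem phiInf_lattice (k : ℕ) (z : ℍ) (r : ℝ) (v : ℤ × ℤ) :
    phiInf k ![(√z.im)⁻¹ * (r * v.1 - z.re * (r * v.2)), (√z.im)⁻¹ * (z.im * (r * v.2))] =
      ((r / √z.im : ℝ) : ℂ) ^ k * (latticePt z v ^ k *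
        (Real.exp (-(Real.pi * ‖latticePt z v‖ ^ 2 / z.im) * r ^ 2) : ℂ)) := by
  have hy : √z.im ≠ 0 := (Real.sqrt_pos.2 z.im_pos).ne'
  have hyy : √z.im ^ 2 = z.im := Real.sq_sqrt z.im_pos.le
  have hyc : (√z.im : ℂ) ≠ 0 := by exact_mod_cast hy
  rw [phiInf, mul_comm, ← mul_assoc (((r / √z.im : ℝ) : ℂ) ^ k), ← mul_pow]
  simp only [Matrix.cons_val_zero, Matrix.cons_val_one]
  refine congrArg₂ (· * ·) (congrArg (· ^ k) ?_) (congrArg (fun x : ℝ => (Real.exp x : ℂ)) ?_)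
  · rw [latticePt_eq]
    push_cast
    field_simp
  · rw [norm_latticePt_sq, mul_pow, mul_pow, inv_pow, hyy]
    have := z.im_pos.ne'
    field_simp

/-- Multiplication by a finite unit preserves Ẑ², so the finite indicator selects exactly the
integral vectors. -/
theorem hasSum_thetaTerm_of_mem {k : ℕ} (hk : k ≠ 0) (z : ℍ) {t : Idele} (ht : t ∈ ideleDomain) :
    HasSum (thetaTerm (phi k) (divIdele (gMat z) t))
      (((infCoord t / √z.im : ℝ) : ℂ) ^ k * latticeTheta z k (infCoord t ^ 2)) := by
  have hr : 0 < infCoord t := ht.1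
  have h1 := ((summable_latticeTheta z k (pow_pos hr 2)).hasSum).mul_left
    (((infCoord t / √z.im : ℝ) : ℂ) ^ k)
  -- The lattice series includes v = 0, the adelic one does not; that term vanishes as k ≠ 0.
  rw [← hasSum_subtype_iff_of_support_subset (s := {v | v ≠ 0})] at h1
  swap
  · intro v hv h0
    exact hv (by simp [latticePt_eq_zero_iff.2 h0, hk])
  rw [← intVec_injective.hasSum_iff]
  · refine Eq.mp (congrArg (fun f => HasSum f _) (funext fun v : {v : ℤ × ℤ // v ≠ 0} => ?_)) h1
    symm
    have hf : (fun i => ((t : Adele) * algebraMap ℚ Adele ((intVec v).1 i)).2) ∈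
        {x : Fin 2 → FinAdele | ∀ i, x i ∈ zHat} := by
      intro i
      refine (finUnits_mul_mem_zHat_iff ht.2 _).2 (algebraMap_mem_zHat_iff.2 ?_)
      fin_cases i
      · exact ⟨v.1.1, rfl⟩
      · exact ⟨v.1.2, rfl⟩
    have e0 : (((intVec v).1 0 : ℚ) : ℝ) = v.1.1 := Rat.cast_intCast _
    have e1 : (((intVec v).1 1 : ℚ) : ℝ) = v.1.2 := Rat.cast_intCast _
    rw [Function.comp_apply, Function.comp_apply, thetaTerm_eq, phi_mulVec, phiFin,
      Set.indicator_of_mem hf, Pi.one_apply, one_mul, ← phiInf_lattice]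
    simp only [infCoord_mul, infCoord_algebraMap, e0, e1]
  · intro v hv
    rw [thetaTerm_eq, phi_mulVec]
    refine mul_eq_zero_of_left (Set.indicator_of_notMem (fun h => hv ?_) _) _
    have h2 (i : Fin 2) : ∃ n : ℤ, (n : ℚ) = v.1 i :=
      algebraMap_mem_zHat_iff.1 ((finUnits_mul_mem_zHat_iff ht.2 _).1 (h i))
    obtain ⟨m, hm⟩ := h2 0
    obtain ⟨n, hn⟩ := h2 1
    have hv' : v.1 = ![(m : ℚ), (n : ℚ)] := by
      ext i
      fin_cases i
      · exact hm.symm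
      · exact hn.symm
    exact ⟨⟨(m, n), fun h0 => v.2 (by
      rw [hv', show m = 0 from congrArg Prod.fst h0, show n = 0 from congrArg Prod.snd h0]
      simp)⟩, Subtype.ext hv'.symm⟩

/-- Multiplication by a nonzero rational number on the nonzero rational vectors. -/
def scaleVec (q : ℚˣ) : {v : Fin 2 → ℚ // v ≠ 0} ≃ {v : Fin 2 → ℚ // v ≠ 0} :=
  (MulAction.toPerm q).subtypeEquiv fun _ => (smul_ne_zero_iff_ne q).symm

theorem thetaTerm_principalIdele_mul (k : ℕ) (z : ℍ) (q : ℚˣ) (t : Idele) :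
    thetaTerm (phi k) (divIdele (gMat z) (principalIdele q * t)) =
      thetaTerm (phi k) (divIdele (gMat z) t) ∘ scaleVec q := by
  ext v
  rw [Function.comp_apply, thetaTerm_eq, thetaTerm_eq]
  congr 2
  ext1 i
  have h : (scaleVec q v).1 i = q * v.1 i := rfl
  rw [h, map_mul, Units.val_mul, principalIdele_val]
  ring

/-- Moving t into the fundamental domain by q only permutes the rational vectors and leaves the norm
unchanged. -/
theorem hasSum_thetaTerm {k : ℕ} (hk : k ≠ 0) (z : ℍ) (t : Idele) :
    HasSum (thetaTerm (phi k) (divIdele (gMat z) t))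
      (((ideleNorm t / √z.im : ℝ) : ℂ) ^ k * latticeTheta z k (ideleNorm t ^ 2)) := by
  obtain ⟨q, hq⟩ := exists_principalIdele_mul_mem t
  have h := hasSum_thetaTerm_of_mem hk z hq
  rwa [thetaTerm_principalIdele_mul, (scaleVec q).hasSum_iff, ← ideleNorm_of_mem_ideleDomain hq,
    ideleNorm_mul, ideleNorm_principalIdele, one_mul] at h

/-! ### The Eisenstein series as a Mellin transform -/

/-- The integrand of the Eisenstein series as a function of the idele norm. -/
def normIntegrand (z : ℍ) (k : ℕ) (s : ℂ) (r : ℝ) : ℂ :=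
  (r : ℂ) ^ (2 * s) * (((r / √z.im : ℝ) : ℂ) ^ k * latticeTheta z k (r ^ 2))

theorem eisIntegrand_eq {k : ℕ} (hk : k ≠ 0) (z : ℍ) (s : ℂ) :
    eisIntegrand 1 s (phi k) (gMat z) = fun q => normIntegrand z k s (classNorm q) := by
  ext q
  rw [eisIntegrand, theta, (hasSum_thetaTerm hk z q.out).tsum_eq, normIntegrand, classNorm]
  simp

theorem continuousOn_normIntegrand (z : ℍ) (k : ℕ) (s : ℂ) :
    ContinuousOn (normIntegrand z k s) (Set.Ioi 0) := by
  refine ContinuousOn.mul ?_ (ContinuousOn.mul (by fun_prop) ?_)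
  · exact fun r (hr : 0 < r) => (Complex.continuous_ofReal.continuousAt.cpow
      continuousAt_const (Complex.ofReal_mem_slitPlane.2 hr)).continuousWithinAt
  · exact (continuousOn_latticeTheta z k).comp (by fun_prop) fun r (hr : 0 < r) => pow_pos hr 2

theorem inv_mul_normIntegrand (z : ℍ) (k : ℕ) (s : ℂ) {r : ℝ} (hr : 0 < r) :
    (r : ℂ)⁻¹ * normIntegrand z k s r = (((√z.im)⁻¹ : ℝ) : ℂ) ^ k *
      ((r : ℂ) ^ (2 * s + k - 1) • latticeTheta z k (r ^ (2 : ℝ))) := by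
  have hr' : (r : ℂ) ≠ 0 := by exact_mod_cast hr.ne'
  rw [normIntegrand, Complex.cpow_sub _ _ hr', Complex.cpow_add _ _ hr', Complex.cpow_one,
    Complex.cpow_natCast, Real.rpow_two, smul_eq_mul, div_eq_mul_inv r, Complex.ofReal_mul, mul_pow]
  ring

theorem integrable_eisIntegrand {k : ℕ} (hk : k ≠ 0) (z : ℍ) {s : ℂ} (hs : 0 < s.re) :
    Integrable (eisIntegrand 1 s (phi k) (gMat z)) ideleClassHaar := by
  rw [eisIntegrand_eq hk, integrable_comp_classNorm_iff (continuousOn_normIntegrand z k s)]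
  have h1 : MellinConvergent (fun r => latticeTheta z k (r ^ (2 : ℝ))) (2 * s + k) := by
    rw [MellinConvergent.comp_rpow two_ne_zero]
    refine mellinConvergent_latticeTheta z hk ?_
    rw [Complex.div_ofReal_re]
    have : (2 * s + (k : ℂ)).re = 2 * s.re + k := by simp
    rw [this]
    positivity
  exact IntegrableOn.congr_fun (h1.const_mul ((((√z.im)⁻¹ : ℝ) : ℂ) ^ k))
    (fun r hr => (inv_mul_normIntegrand z k s hr).symm) measurableSet_Ioi

theorem det_gMat (z : ℍ) : Matrix.GeneralLinearGroup.det (gMat z) = 1 := by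
  have hy : √z.im ≠ 0 := (Real.sqrt_pos.2 z.im_pos).ne'
  have hd : (realMatrix z).1.det = 1 := by
    simp [realMatrix, Matrix.GeneralLinearGroup.mkOfDetNeZero, Matrix.det_fin_two_of, hy]
  refine Units.ext ?_
  change (infMatrix (realMatrix z).1).det = 1
  rw [Matrix.det_fin_two] at hd ⊢
  refine Prod.ext ?_ ?_
  · have := congrArg infEquiv.symm hd
    rw [map_sub, map_mul, map_mul, map_one] at this
    exact this
  · change (1 * 1 - 0 * 0 : FinAdele) = 1
    ring

/-- The factor 1/2 is the Jacobian of T = r², for which dr/r = dT/(2T); the shift by k/2 comes from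
the factor r^k of the theta series. -/
theorem eisenstein_eq_mellin {k : ℕ} (hk : k ≠ 0) (z : ℍ) (s : ℂ) :
    eisenstein 1 s (phi k) (gMat z) =
      1 / 2 * (((√z.im)⁻¹ : ℝ) : ℂ) ^ k * mellin (latticeTheta z k) (s + k / 2) := by
  have h1 : ideleNorm 1 = 1 := by rw [← map_one principalIdele, ideleNorm_principalIdele]
  have h2 := mellin_comp_rpow (latticeTheta z k) (2 * s + k) 2
  rw [eisenstein, det_gMat, h1, Complex.ofReal_one, Complex.one_cpow, one_mul,
    eisIntegrand_eq hk, integral_comp_classNorm (continuousOn_normIntegrand z k s),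
    setIntegral_congr_fun measurableSet_Ioi fun r hr => inv_mul_normIntegrand z k s hr,
    integral_const_mul]
  rw [mellin] at h2
  rw [h2, abs_of_pos two_pos, Complex.real_smul]
  have : (2 * s + k) / ((2 : ℝ) : ℂ) = s + k / 2 := by
    push_cast
    ring
  rw [this]
  push_cast
  ring

theorem differentiableAt_eisenstein {k : ℕ} (hk : k ≠ 0) (z : ℍ) {s : ℂ} (hs : 0 < s.re) :
    DifferentiableAt ℂ (fun s => eisenstein 1 s (phi k) (gMat z)) s := by
  simp_rw [eisenstein_eq_mellin hk]
  refine DifferentiableAt.const_mul ?_ _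
  refine DifferentiableAt.comp (g := mellin (latticeTheta z k)) (f := fun s : ℂ => s + k / 2) s
    (differentiableAt_mellin_latticeTheta z hk ?_) (by fun_prop)
  have : (s + (k : ℂ) / 2).re = s.re + k / 2 := by simp
  rw [this]
  positivity

/-! ### Explicit formulas -/

theorem ofReal_cpow_eq_exp {a : ℝ} (ha : 0 < a) (s : ℂ) :
    (a : ℂ) ^ s = Complex.exp (Real.log a * s) := by
  rw [Complex.cpow_def_of_ne_zero (by exact_mod_cast ha.ne'), Complex.ofReal_log ha.le]

/-- The constant in front of the explicit Eisenstein series. -/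
def eisFactor (z : ℍ) (k : ℕ) (s : ℂ) : ℂ :=
  1 / 2 * (z.im : ℂ) ^ s * Complex.Gamma (s + k / 2) * (Real.pi : ℂ) ^ (-(s + k / 2))

theorem mellin_term_eq (z : ℍ) (k : ℕ) (s : ℂ) {v : ℤ × ℤ} (hv : v ≠ 0) :
    1 / 2 * (((√z.im)⁻¹ : ℝ) : ℂ) ^ k * (Complex.Gamma (s + k / 2) * latticePt z v ^ k /
      ((Real.pi * ‖latticePt z v‖ ^ 2 / z.im : ℝ) : ℂ) ^ (s + k / 2)) =
    eisFactor z k s *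
      (latticePt z v ^ k * (‖latticePt z v‖ : ℂ) ^ (-(k : ℂ) - 2 * s)) := by
  have hy := z.im_pos
  have hr : 0 < ‖latticePt z v‖ := norm_pos_iff.2 fun h => hv (latticePt_eq_zero_iff.1 h)
  have hpi := Real.pi_pos
  have hsq : 0 < (√z.im)⁻¹ := inv_pos.2 (Real.sqrt_pos.2 hy)
  have e1 : Real.log ((√z.im)⁻¹) = -(Real.log z.im / 2) := by
    rw [Real.log_inv, Real.log_sqrt hy.le]
  have e2 : Real.log (Real.pi * ‖latticePt z v‖ ^ 2 / z.im) =
      Real.log Real.pi + 2 * Real.log ‖latticePt z v‖ - Real.log z.im := by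
    rw [Real.log_div (by positivity) hy.ne', Real.log_mul hpi.ne' (by positivity), Real.log_pow]
    norm_num
  have key : (((√z.im)⁻¹ : ℝ) : ℂ) ^ k *
      (((Real.pi * ‖latticePt z v‖ ^ 2 / z.im : ℝ) : ℂ) ^ (s + k / 2))⁻¹ =
      (z.im : ℂ) ^ s * (Real.pi : ℂ) ^ (-(s + k / 2)) *
        (‖latticePt z v‖ : ℂ) ^ (-(k : ℂ) - 2 * s) := by
    -- All bases are positive reals, so the identity of powers reduces to a linear one between
    -- logarithms.
    rw [← Complex.cpow_natCast, ofReal_cpow_eq_exp hsq, ofReal_cpow_eq_exp (by positivity),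
      ofReal_cpow_eq_exp hy, ofReal_cpow_eq_exp hpi, ofReal_cpow_eq_exp hr, e1, e2,
      ← Complex.exp_neg, ← Complex.exp_add, ← Complex.exp_add, ← Complex.exp_add]
    push_cast
    congr 1
    ring
  rw [eisFactor, div_eq_mul_inv (Complex.Gamma _ * _)]
  linear_combination (1 / 2 * Complex.Gamma (s + k / 2) * latticePt z v ^ k) * key

theorem gamma_ne_zero_of_re_pos {s : ℂ} (k : ℕ) (hs : 0 < s.re) :
    Complex.Gamma (s + k / 2) ≠ 0 := by
  refine Complex.Gamma_ne_zero_of_re_pos ?_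
  have : (s + (k : ℂ) / 2).re = s.re + k / 2 := by simp
  rw [this]
  positivity

/-- Needed to divide by the factor, both to isolate the summability of the lattice series and in the
Hecke limit. -/
theorem eisFactor_ne_zero (z : ℍ) (k : ℕ) {s : ℂ} (hs : 0 < s.re) : eisFactor z k s ≠ 0 := by
  have hy := z.im_pos
  rw [eisFactor, ofReal_cpow_eq_exp hy, ofReal_cpow_eq_exp Real.pi_pos]
  simp [Complex.exp_ne_zero, gamma_ne_zero_of_re_pos k hs]

theorem hasSum_eisenstein {k : ℕ} (hk : k ≠ 0) (z : ℍ) {s : ℂ} (hs : 1 < s.re) :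
    HasSum (fun v : {v : ℤ × ℤ // v ≠ 0} => eisFactor z k s *
        (latticePt z v ^ k * (‖latticePt z v‖ : ℂ) ^ (-(k : ℂ) - 2 * s)))
      (eisenstein 1 s (phi k) (gMat z)) := by
  have hre : (k : ℝ) / 2 + 1 < (s + (k : ℂ) / 2).re := by
    have : (s + (k : ℂ) / 2).re = s.re + k / 2 := by simp
    rw [this]
    linarith
  have h := (hasSum_mellin_latticeTheta z hk hre).mul_left
    (1 / 2 * (((√z.im)⁻¹ : ℝ) : ℂ) ^ k)
  rw [← eisenstein_eq_mellin hk, ← hasSum_subtype_iff_of_support_subset (s := {v | v ≠ 0})] at h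
  · refine Eq.mp (congrArg (fun f => HasSum f _)
      (funext fun v : {v : ℤ × ℤ // v ≠ 0} => ?_)) h
    exact mellin_term_eq z k s v.2
  · intro v hv h0
    exact hv (by simp [latticePt_eq_zero_iff.2 h0, hk])

theorem summable_eisenstein {k : ℕ} (hk : k ≠ 0) (z : ℍ) {s : ℂ} (hs : 1 < s.re) :
    Summable fun v : {v : ℤ × ℤ // v ≠ 0} =>
      latticePt z v ^ k * (‖latticePt z v‖ : ℂ) ^ (-(k : ℂ) - 2 * s) :=
  (summable_mul_left_iff (eisFactor_ne_zero z k (zero_lt_one.trans hs))).1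
    (hasSum_eisenstein hk z hs).summable

theorem eisenstein_eq_tsum {k : ℕ} (hk : k ≠ 0) (z : ℍ) {s : ℂ} (hs : 1 < s.re) :
    eisenstein 1 s (phi k) (gMat z) = eisFactor z k s * ∑' v : {v : ℤ × ℤ // v ≠ 0},
      latticePt z v ^ k * (‖latticePt z v‖ : ℂ) ^ (-(k : ℂ) - 2 * s) := by
  rw [← tsum_mul_left, (hasSum_eisenstein hk z hs).tsum_eq]

/-! ### Passage to the holomorphic form and the value at s = k/2. -/

/-- The reflection `(v₁, v₂) ↦ (v₁, -v₂)` of the nonzero integral vectors. -/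
def reflect : {v : ℤ × ℤ // v ≠ 0} ≃ {v : ℤ × ℤ // v ≠ 0} :=
  ((Equiv.refl ℤ).prodCongr (Equiv.neg ℤ)).subtypeEquiv fun v => by
    simp [Prod.ext_iff]

theorem conj_latticePt_reflect (z : ℍ) (v : {v : ℤ × ℤ // v ≠ 0}) :
    starRingEnd ℂ (latticePt z (reflect v)) = (v.1.1 : ℂ) + v.1.2 * z := by
  have h : (reflect v).1 = (v.1.1, -v.1.2) := rfl
  rw [latticePt, h]
  simp

/-- With |P|² = P P̄ one has P^k |P|^{-2k} = P̄^{-k}, and the reflection makes P̄ equal to v₁ + v₂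
z. -/
theorem latticePt_reflect_term (z : ℍ) (k : ℕ) (e : ℂ) (v : {v : ℤ × ℤ // v ≠ 0}) :
    latticePt z (reflect v) ^ k *
        (‖latticePt z (reflect v)‖ : ℂ) ^ (-(k : ℂ) - 2 * (k / 2 + e)) =
      (((v.1.1 : ℂ) + v.1.2 * z) ^ k)⁻¹ * (‖(v.1.1 : ℂ) + v.1.2 * z‖ : ℂ) ^ (-2 * e) := by
  rw [← conj_latticePt_reflect, Complex.norm_conj]
  have h0 : latticePt z (reflect v) ≠ 0 := fun h => (reflect v).2 (latticePt_eq_zero_iff.1 h)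
  generalize latticePt z (reflect v) = P at h0
  have hr : (‖P‖ : ℂ) ≠ 0 := by simpa using h0
  have hc : starRingEnd ℂ P ≠ 0 := by simpa using h0
  have h1 : (‖P‖ : ℂ) ^ 2 = P * starRingEnd ℂ P := (Complex.mul_conj' P).symm
  have h2 : -(k : ℂ) - 2 * (k / 2 + e) = -2 * e - ((2 * k : ℕ) : ℂ) := by
    push_cast
    ring
  rw [h2, Complex.cpow_sub _ _ hr, Complex.cpow_natCast, pow_mul, h1, mul_pow]
  field_simp

theorem summable_reflect_iff (z : ℍ) (k : ℕ) (e : ℂ) :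
    Summable (fun v : {v : ℤ × ℤ // v ≠ 0} =>
      latticePt z v ^ k * (‖latticePt z v‖ : ℂ) ^ (-(k : ℂ) - 2 * (k / 2 + e))) ↔
    Summable (fun v : {v : ℤ × ℤ // v ≠ 0} =>
      (((v.1.1 : ℂ) + v.1.2 * z) ^ k)⁻¹ * (‖(v.1.1 : ℂ) + v.1.2 * z‖ : ℂ) ^ (-2 * e)) := by
  rw [← reflect.summable_iff]
  exact summable_congr (latticePt_reflect_term z k e)

theorem tsum_reflect (z : ℍ) (k : ℕ) (e : ℂ) :
    ∑' v : {v : ℤ × ℤ // v ≠ 0},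
      latticePt z v ^ k * (‖latticePt z v‖ : ℂ) ^ (-(k : ℂ) - 2 * (k / 2 + e)) =
    ∑' v : {v : ℤ × ℤ // v ≠ 0},
      (((v.1.1 : ℂ) + v.1.2 * z) ^ k)⁻¹ * (‖(v.1.1 : ℂ) + v.1.2 * z‖ : ℂ) ^ (-2 * e) := by
  rw [← reflect.tsum_eq]
  exact tsum_congr (latticePt_reflect_term z k e)

theorem eisFactor_half (z : ℍ) (k : ℕ) : eisFactor z k (k / 2) =
    1 / 2 * (z.im : ℂ) ^ ((k : ℂ) / 2) * Complex.Gamma k * ((Real.pi : ℂ) ^ k)⁻¹ := by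
  rw [eisFactor, add_halves, Complex.cpow_neg, Complex.cpow_natCast]

theorem continuousAt_eisFactor (z : ℍ) (k : ℕ) {s : ℂ} (hs : 0 < s.re) :
    ContinuousAt (eisFactor z k) s := by
  have hy : (z.im : ℂ) ≠ 0 := by exact_mod_cast z.im_pos.ne'
  have hpi : (Real.pi : ℂ) ≠ 0 := by exact_mod_cast Real.pi_ne_zero
  have hre : 0 < (s + (k : ℂ) / 2).re := by
    have : (s + (k : ℂ) / 2).re = s.re + k / 2 := by simp
    rw [this]
    positivity
  have hG : ContinuousAt (fun s : ℂ => Complex.Gamma (s + k / 2)) s :=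
    ContinuousAt.comp (g := Complex.Gamma) (f := fun s : ℂ => s + k / 2)
      (Complex.differentiableAt_Gamma _ fun m h => by
        rw [h] at hre
        simp only [Complex.neg_re, Complex.natCast_re] at hre
        linarith [(Nat.cast_nonneg m : (0 : ℝ) ≤ m)]).continuousAt (by fun_prop)
  have h1 : ContinuousAt (fun s : ℂ => (z.im : ℂ) ^ s) s := continuousAt_const_cpow hy
  have h2 : ContinuousAt (fun s : ℂ => (Real.pi : ℂ) ^ (-(s + k / 2))) s :=
    ContinuousAt.comp (g := fun u : ℂ => (Real.pi : ℂ) ^ u) (f := fun s : ℂ => -(s + k / 2))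
      (continuousAt_const_cpow hpi) (by fun_prop)
  exact ((continuousAt_const.mul h1).mul hG).mul h2

end AdelicEisenstein
end

theorem mainTheorem9 (k : ℕ) (hk : 2 ≤ k) (z : ℍ) :
    -- absolute convergence of the theta series and of the integral, and holomorphy, for `Re s > 0`
    (∀ t : AdelicEisenstein.Idele,
      Summable (AdelicEisenstein.thetaTerm (AdelicEisenstein.phi k)
        (AdelicEisenstein.divIdele (AdelicEisenstein.gMat z) t))) ∧
    (∀ s : ℂ, 0 < s.re →
      Integrable (AdelicEisenstein.eisIntegrand 1 s (AdelicEisenstein.phi k)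
        (AdelicEisenstein.gMat z)) AdelicEisenstein.ideleClassHaar) ∧
    DifferentiableOn ℂ (fun s : ℂ =>
      AdelicEisenstein.eisenstein 1 s (AdelicEisenstein.phi k) (AdelicEisenstein.gMat z))
      {s : ℂ | 0 < s.re} ∧
    -- the explicit formula
    (∀ s : ℂ, 1 < s.re →
      Summable (fun v : {v : ℤ × ℤ // v ≠ 0} =>
        ((v.1.1 : ℂ) - v.1.2 * starRingEnd ℂ (z : ℂ)) ^ k *
          (‖(v.1.1 : ℂ) - v.1.2 * starRingEnd ℂ (z : ℂ)‖ : ℂ) ^ (-(k : ℂ) - 2 * s)) ∧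
      AdelicEisenstein.eisenstein 1 s (AdelicEisenstein.phi k) (AdelicEisenstein.gMat z) =
        (1 / 2 : ℂ) * (z.im : ℂ) ^ s * Complex.Gamma (s + k / 2) *
          (Real.pi : ℂ) ^ (-(s + k / 2)) *
          ∑' v : {v : ℤ × ℤ // v ≠ 0},
            ((v.1.1 : ℂ) - v.1.2 * starRingEnd ℂ (z : ℂ)) ^ k *
              (‖(v.1.1 : ℂ) - v.1.2 * starRingEnd ℂ (z : ℂ)‖ : ℂ) ^ (-(k : ℂ) - 2 * s)) ∧
    -- the value at `s = k / 2` when the classical Eisenstein series converges absolutely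
    (3 ≤ k →
      Summable (fun v : {v : ℤ × ℤ // v ≠ 0} => (((v.1.1 : ℂ) + v.1.2 * (z : ℂ)) ^ k)⁻¹) ∧
      AdelicEisenstein.eisenstein 1 (k / 2) (AdelicEisenstein.phi k) (AdelicEisenstein.gMat z) =
        (1 / 2 : ℂ) * (z.im : ℂ) ^ ((k : ℂ) / 2) * Complex.Gamma k * ((Real.pi : ℂ) ^ k)⁻¹ *
          ∑' v : {v : ℤ × ℤ // v ≠ 0}, (((v.1.1 : ℂ) + v.1.2 * (z : ℂ)) ^ k)⁻¹) ∧
    -- the value at `s = k / 2` in general, the series being summed by Hecke's method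
    ((∀ ε : ℝ, 0 < ε →
      Summable (fun v : {v : ℤ × ℤ // v ≠ 0} => (((v.1.1 : ℂ) + v.1.2 * (z : ℂ)) ^ k)⁻¹ *
        (‖(v.1.1 : ℂ) + v.1.2 * (z : ℂ)‖ : ℂ) ^ (-2 * (ε : ℂ)))) ∧
      Tendsto (fun ε : ℝ =>
        (1 / 2 : ℂ) * (z.im : ℂ) ^ ((k : ℂ) / 2) * Complex.Gamma k * ((Real.pi : ℂ) ^ k)⁻¹ *
          ∑' v : {v : ℤ × ℤ // v ≠ 0}, (((v.1.1 : ℂ) + v.1.2 * (z : ℂ)) ^ k)⁻¹ *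
            (‖(v.1.1 : ℂ) + v.1.2 * (z : ℂ)‖ : ℂ) ^ (-2 * (ε : ℂ)))
        (𝓝[>] 0)
        (𝓝 (AdelicEisenstein.eisenstein 1 (k / 2) (AdelicEisenstein.phi k)
          (AdelicEisenstein.gMat z)))) := by
  have hk0 : k ≠ 0 := by omega
  have hkr : (2 : ℝ) ≤ k := by exact_mod_cast hk
  have hre (ε : ℝ) : ((k : ℂ) / 2 + (ε : ℂ)).re = k / 2 + ε := by simp
  have hre0 : 0 < ((k : ℂ) / 2).re := by
    have : ((k : ℂ) / 2).re = k / 2 := by simp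
    rw [this]
    positivity
  refine ⟨fun t => (AdelicEisenstein.hasSum_thetaTerm hk0 z t).summable,
    fun s hs => AdelicEisenstein.integrable_eisIntegrand hk0 z hs,
    fun s hs => (AdelicEisenstein.differentiableAt_eisenstein hk0 z hs).differentiableWithinAt,
    fun s hs => ⟨AdelicEisenstein.summable_eisenstein hk0 z hs,
      AdelicEisenstein.eisenstein_eq_tsum hk0 z hs⟩, fun hk3 => ?_, fun ε hε => ?_, ?_⟩
  · have hk3r : (3 : ℝ) ≤ k := by exact_mod_cast hk3
    -- For k ≥ 3 the point k/2 already lies in Re s > 1, so ε = 0 is admissible.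
    have h1 : 1 < ((k : ℂ) / 2 + ((0 : ℝ) : ℂ)).re := by
      rw [hre]
      linarith
    have hs := AdelicEisenstein.summable_eisenstein hk0 z h1
    have he := AdelicEisenstein.eisenstein_eq_tsum hk0 z h1
    rw [AdelicEisenstein.summable_reflect_iff] at hs
    rw [AdelicEisenstein.tsum_reflect] at he
    simp only [Complex.ofReal_zero, mul_zero, Complex.cpow_zero, mul_one, add_zero] at hs he
    exact ⟨hs, he.trans (by rw [AdelicEisenstein.eisFactor_half])⟩
  · rw [← AdelicEisenstein.summable_reflect_iff]
    refine AdelicEisenstein.summable_eisenstein hk0 z ?_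
    rw [hre]
    linarith
  · have hlim : Tendsto (fun ε : ℝ => (k : ℂ) / 2 + (ε : ℂ)) (𝓝[>] 0) (𝓝 ((k : ℂ) / 2)) := by
      have : Continuous fun ε : ℝ => (k : ℂ) / 2 + (ε : ℂ) := by fun_prop
      simpa using (this.tendsto 0).mono_left nhdsWithin_le_nhds
    have hE1 := (AdelicEisenstein.differentiableAt_eisenstein hk0 z hre0).continuousAt.tendsto.comp
      hlim
    have hA1 := (AdelicEisenstein.continuousAt_eisFactor z k hre0).tendsto.comp hlim
    have hA0 := AdelicEisenstein.eisFactor_ne_zero z k hre0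
    -- In the Hecke formula the prefactor is frozen at k/2, whereas the explicit formula has it at
    -- k/2 + ε. The lattice sum is therefore written as E divided by the moving factor, and both are
    -- continuous at k/2.
    have h := (hE1.div hA1 hA0).const_mul (AdelicEisenstein.eisFactor z k (k / 2))
    rw [mul_div_cancel₀ _ hA0] at h
    refine h.congr' ?_
    filter_upwards [self_mem_nhdsWithin] with ε hε
    have hε' : 0 < ε := hε
    have h1 : 1 < ((k : ℂ) / 2 + (ε : ℂ)).re := by
      rw [hre]
      linarith
    have he := AdelicEisenstein.eisenstein_eq_tsum hk0 z h1
    rw [AdelicEisenstein.tsum_reflect] at he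
    rw [← AdelicEisenstein.eisFactor_half]
    congr 1
    simp only [Function.comp_apply, Pi.div_apply]
    rw [he, mul_div_cancel_left₀ _
      (AdelicEisenstein.eisFactor_ne_zero z k (zero_lt_one.trans h1))]
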